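/- Let $G=\mathrm{SL}(2,\mathbb R)\ltimes\mathbb R^2$ with multiplication law $(M,\xi)(M',\xi')=(MM',\xi M'+\xi')$, acting from the right on row vectors $x\in\mathbb R^2$ by $x(M,\xi)=xM+\xi$. Let $$\Gamma_{2,0}(4)=\Big\{M\in\mathrm{SL}(2,\mathbb Z)\ \Big|\ M\equiv\begin{pmatrix}1&0\\0&1\end{pmatrix}\text{ or }\begin{pmatrix}1&2\\0&1\end{pmatrix}\bmod 4\Big\},\qquad \Lambda=\Gamma_{2,0}(4)\ltimes\mathbb Z^2\subset G,$$ and let $\mu$ be the unique $G$-invariant Borel probability measure on $Y=\Lambda\backslash G$, where $G$ acts on $Y$ by right translation. For $f:\mathbb R^2\times\mathbb R^2\to\mathbb R$ and $g\in G$ put $$R_f^+(g)=\sum_{\substack{m_1,m_2\in\mathbb Z^2\\ m_1\neq m_2}} f(m_1g,m_2g),\qquad R_f^-(g)=\sum_{m_1,m_2\in\mathbb Z^2} f\big(m_1g,-[m_2(1,(\tfrac12,-\tfrac14))g]\big);$$ these depend only on the coset $\Lambda g$. If $f\in L^1(\mathbb R^2\times\mathbb R^2)$ (with respect to Lebesgue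 measure), then for each choice of sign the series $R_f^\pm(g)$ converges absolutely for $\mu$-almost every $\Lambda g\in Y$, the function $R_f^\pm$ is $\mu$-integrable, and $$\int_Y R_f^\pm(g)\,d\mu(g)=\int_{\mathbb R^2\times\mathbb R^2} f(x,y)\,dx\,dy .$$ -/

import Mathlib

open MeasureTheory Matrix

noncomputable section

namespace TwoPoint

/-- The plane, as a space of row vectors. Its `volume` is Lebesgue measure. -/
abbrev Plane : Type := Fin 2 → ℝ

/-- The integer lattice `ℤ²`, as a space of row vectors. -/
abbrev Lattice : Type := Fin 2 → ℤ

/-- The inclusion of `ℤ²` in the plane. -/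
def toPlane (m : Lattice) : Plane := fun i => (m i : ℝ)

/-- Real `2 × 2` matrices. -/
abbrev Mat : Type := Matrix (Fin 2) (Fin 2) ℝ

/-- The affine special linear group `ASL(2, ℝ) = SL(2, ℝ) ⋉ ℝ²`; its elements are the
pairs `(M, ξ)`. -/
@[ext]
structure ASL : Type where
  /-- the linear part -/
  lin : SpecialLinearGroup (Fin 2) ℝ
  /-- the translation part -/
  trans : Plane

namespace ASL

/-- The multiplication law is `(M, ξ) (M', ξ') = (M M', ξ M' + ξ')`. -/
instance : Mul ASL := ⟨fun g h => ⟨g.lin * h.lin, g.trans ᵥ* (h.lin : Mat) + h.trans⟩⟩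

instance : One ASL := ⟨⟨1, 0⟩⟩

instance : Inv ASL := ⟨fun g => ⟨g.lin⁻¹, -(g.trans ᵥ* ((g.lin⁻¹ : SpecialLinearGroup (Fin 2) ℝ) : Mat))⟩⟩

@[simp] theorem mul_lin (g h : ASL) : (g * h).lin = g.lin * h.lin := rfl

@[simp] theorem mul_trans (g h : ASL) :
    (g * h).trans = g.trans ᵥ* (h.lin : Mat) + h.trans := rfl

@[simp] theorem one_lin : (1 : ASL).lin = 1 := rfl

@[simp] theorem one_trans : (1 : ASL).trans = 0 := rfl

@[simp] theorem inv_lin (g : ASL) : (g⁻¹).lin = g.lin⁻¹ := rfl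

@[simp] theorem inv_trans (g : ASL) : (g⁻¹).trans = -(g.trans ᵥ* ((g.lin⁻¹ : SpecialLinearGroup (Fin 2) ℝ) : Mat)) := rfl

instance : Group ASL :=
  Group.ofLeftAxioms
    (by
      intro a b c
      ext1
      · simp [mul_assoc]
      · simp [Matrix.add_vecMul, Matrix.vecMul_vecMul, add_assoc])
    (by
      intro a
      ext1 <;> simp)
    (by
      intro a
      ext1
      · simp
      · have h : ((a.lin⁻¹ : SpecialLinearGroup (Fin 2) ℝ) : Mat) * (a.lin : Mat) = 1 :=
          congrArg Subtype.val (inv_mul_cancel a.lin)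
        rw [mul_trans, inv_trans, Matrix.neg_vecMul, Matrix.vecMul_vecMul, h]
        simp)

/-- The topology of `SL(2, ℝ) × ℝ²`. -/
instance : TopologicalSpace ASL :=
  TopologicalSpace.induced (fun g : ASL => (g.lin, g.trans)) inferInstance

end ASL

/-- The right action of `ASL(2, ℝ)` on the plane, `x (M, ξ) = x M + ξ`. -/
def act (x : Plane) (g : ASL) : Plane := x ᵥ* (g.lin : Mat) + g.trans

theorem act_mul (x : Plane) (g h : ASL) : act x (g * h) = act (act x g) h := by
  simp [act, Matrix.add_vecMul, Matrix.vecMul_vecMul, add_assoc]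

theorem act_one (x : Plane) : act x 1 = x := by
  simp [act]

/-- The matrix with rows `(1, 2)` and `(0, 1)`, modulo `4`. -/
def unip : SpecialLinearGroup (Fin 2) (ZMod 4) :=
  ⟨!![1, 2; 0, 1], by simp [Matrix.det_fin_two]⟩

theorem unip_mul_self : unip * unip = 1 := by
  apply Subtype.ext
  show (!![1, 2; 0, 1] : Matrix (Fin 2) (Fin 2) (ZMod 4)) * !![1, 2; 0, 1] = 1
  decide

/-- Entrywise reduction modulo `4`. -/
def red : SpecialLinearGroup (Fin 2) ℤ →* SpecialLinearGroup (Fin 2) (ZMod 4) :=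
  SpecialLinearGroup.map (Int.castRingHom (ZMod 4))

/-- The congruence subgroup of all `M` in `SL(2, ℤ)` that are congruent modulo `4` to the
identity or to the matrix with rows `(1, 2)` and `(0, 1)`. -/
def congrSubgroup : Subgroup (SpecialLinearGroup (Fin 2) ℤ) where
  carrier := {M | red M = 1 ∨ red M = unip}
  one_mem' := Or.inl (map_one red)
  mul_mem' := by
    rintro a b (ha | ha) (hb | hb)
    · left; simp [ha, hb]
    · right; simp [ha, hb]
    · right; simp [ha, hb]
    · left; simp [ha, hb, unip_mul_self]
  inv_mem' := by
    rintro a (ha | ha)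
    · left; simp [ha]
    · right; simpa [ha] using inv_eq_of_mul_eq_one_left unip_mul_self

/-- The inclusion of `SL(2, ℤ)` in `SL(2, ℝ)`. -/
def toReal : SpecialLinearGroup (Fin 2) ℤ →* SpecialLinearGroup (Fin 2) ℝ :=
  SpecialLinearGroup.map (Int.castRingHom ℝ)

theorem toPlane_vecMul (m : Lattice) (M : SpecialLinearGroup (Fin 2) ℤ) :
    toPlane m ᵥ* (toReal M : Mat) = toPlane (m ᵥ* M.1) := by
  ext i
  simp [toPlane, toReal, Matrix.vecMul, dotProduct]

theorem toPlane_add (m n : Lattice) : toPlane (m + n) = toPlane m + toPlane n := by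
  ext i
  simp [toPlane]

theorem toPlane_neg (m : Lattice) : toPlane (-m) = -toPlane m := by
  ext i
  simp [toPlane]

theorem toPlane_injective : Function.Injective toPlane := by
  intro m n h
  ext i
  have := congrFun h i
  simpa [toPlane] using this

/-- The subgroup `Λ` of all `(M, n)` in `ASL(2, ℝ)` with `M` in the congruence subgroup and
`n` in `ℤ²`. -/
def Lam : Subgroup ASL where
  carrier := {g | (∃ M ∈ congrSubgroup, g.lin = toReal M) ∧ ∃ n : Lattice, g.trans = toPlane n}
  one_mem' := ⟨⟨1, one_mem _, by simp⟩, ⟨0, by ext i; simp [toPlane]⟩⟩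
  mul_mem' := by
    rintro a b ⟨⟨M, hM, ha⟩, m, hm⟩ ⟨⟨N, hN, hb⟩, n, hn⟩
    refine ⟨⟨M * N, mul_mem hM hN, by simp [ha, hb]⟩, ⟨m ᵥ* N.1 + n, ?_⟩⟩
    rw [ASL.mul_trans, hm, hn, hb, toPlane_vecMul, toPlane_add]
  inv_mem' := by
    rintro a ⟨⟨M, hM, ha⟩, m, hm⟩
    refine ⟨⟨M⁻¹, inv_mem hM, by simp [ha]⟩, ⟨-(m ᵥ* (M⁻¹).1), ?_⟩⟩
    rw [ASL.inv_trans, hm, ha, ← map_inv, toPlane_vecMul, toPlane_neg]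

/-- The homogeneous space `Y = Λ \ ASL(2, ℝ)` of all cosets `Λ g`. -/
abbrev Y : Type := Quotient (QuotientGroup.rightRel Lam)

/-- The coset `Λ g`. -/
def coset (g : ASL) : Y := Quotient.mk _ g

/-- `Y` has the quotient topology (found by instance search) and its Borel sets. -/
instance : MeasurableSpace Y := borel Y

instance : BorelSpace Y := ⟨rfl⟩

theorem rightRel_iff (a b : ASL) :
    (QuotientGroup.rightRel Lam) a b ↔ ∃ γ ∈ Lam, b = γ * a := by
  rw [QuotientGroup.rightRel_apply]
  constructor
  · intro h
    exact ⟨_, h, by simp⟩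
  · rintro ⟨γ, h, rfl⟩
    simpa using h

/-- Right translation `Λ g ↦ Λ g h` of `Y` by an element `h` of `ASL(2, ℝ)`. -/
def translate (h : ASL) : Y → Y :=
  Quotient.map (fun g => g * h) (by
    intro a b hab
    obtain ⟨γ, hγ, rfl⟩ := (rightRel_iff a b).1 hab
    exact (rightRel_iff _ _).2 ⟨γ, hγ, mul_assoc _ _ _⟩)

/-- `μ` is an `ASL(2, ℝ)`-invariant Borel probability measure on `Y`. (There is exactly one.) -/
structure IsInvariantProbability (μ : Measure Y) : Prop where
  prob : IsProbabilityMeasure μ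
  invariant : ∀ h : ASL, μ.map (translate h) = μ

/-- The element `(1, (1/2, -1/4))` of `ASL(2, ℝ)`. -/
def shift : ASL := ⟨1, ![1 / 2, -1 / 4]⟩

/-- The pairs of distinct points of `ℤ²`. -/
abbrev DistinctPairs : Type := {p : Lattice × Lattice // p.1 ≠ p.2}

/-- The terms `f (m₁ g, m₂ g)`, over all distinct `m₁`, `m₂` in `ℤ²`. -/
def termPlus (f : Plane × Plane → ℝ) (g : ASL) (p : DistinctPairs) : ℝ :=
  f (act (toPlane p.1.1) g, act (toPlane p.1.2) g)

/-- The terms `f (m₁ g, -[m₂ (1, (1/2, -1/4)) g])`, over all `m₁`, `m₂` in `ℤ²`. -/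
def termMinus (f : Plane × Plane → ℝ) (g : ASL) (p : Lattice × Lattice) : ℝ :=
  f (act (toPlane p.1) g, -(act (toPlane p.2) (shift * g)))

/-- The action of an element of `Λ` permutes `ℤ²`. -/
theorem exists_equiv {γ : ASL} (hγ : γ ∈ Lam) :
    ∃ e : Lattice ≃ Lattice, ∀ m, act (toPlane m) γ = toPlane (e m) := by
  have key : ∀ δ ∈ Lam, ∃ e : Lattice → Lattice, ∀ m, act (toPlane m) δ = toPlane (e m) := by
    rintro δ ⟨⟨M, -, hM⟩, n, hn⟩
    refine ⟨fun m => m ᵥ* M.1 + n, fun m => ?_⟩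
    rw [act, hM, hn, toPlane_vecMul, toPlane_add]
  obtain ⟨e, he⟩ := key γ hγ
  obtain ⟨d, hd⟩ := key γ⁻¹ (inv_mem hγ)
  refine ⟨⟨e, d, fun m => ?_, fun m => ?_⟩, he⟩
  · apply toPlane_injective
    rw [← hd, ← he, ← act_mul, mul_inv_cancel, act_one]
  · apply toPlane_injective
    rw [← he, ← hd, ← act_mul, inv_mul_cancel, act_one]

/-- The shift by `(1/2, -1/4)` normalizes `Λ`. -/
theorem shift_conj {γ : ASL} (hγ : γ ∈ Lam) : shift * γ * shift⁻¹ ∈ Lam := by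
  obtain ⟨⟨M, hM, hl⟩, n, hn⟩ := hγ
  refine ⟨⟨M, hM, by simp [shift, hl]⟩, ?_⟩
  have h4 : (4 : ℤ) ∣ M.1 0 0 - 1 ∧ (2 : ℤ) ∣ M.1 0 1 ∧ (4 : ℤ) ∣ M.1 1 0
      ∧ (4 : ℤ) ∣ M.1 1 1 - 1 := by
    have ent : ∀ i j, (red M).1 i j = ((M.1 i j : ℤ) : ZMod 4) := fun i j => rfl
    have dvd4 : ∀ a : ℤ, ((a : ℤ) : ZMod 4) = 0 → (4 : ℤ) ∣ a := fun a h =>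
      (ZMod.intCast_zmod_eq_zero_iff_dvd a 4).1 h
    rcases hM with h | h
    · have e00 := ent 0 0
      have e01 := ent 0 1
      have e10 := ent 1 0
      have e11 := ent 1 1
      rw [h] at e00 e01 e10 e11
      simp at e00 e01 e10 e11
      have d01 := dvd4 _ e01.symm
      exact ⟨dvd4 _ (by push_cast; rw [← e00]; simp), by omega, dvd4 _ e10.symm,
        dvd4 _ (by push_cast; rw [← e11]; simp)⟩
    · have e00 := ent 0 0
      have e01 := ent 0 1
      have e10 := ent 1 0
      have e11 := ent 1 1
      rw [h] at e00 e01 e10 e11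
      simp [unip] at e00 e01 e10 e11
      have d01 := dvd4 (M.1 0 1 - 2) (by push_cast; rw [← e01]; simp)
      exact ⟨dvd4 _ (by push_cast; rw [← e00]; simp), by omega, dvd4 _ e10.symm,
        dvd4 _ (by push_cast; rw [← e11]; simp)⟩
  obtain ⟨⟨a, ha⟩, ⟨b, hb⟩, ⟨c, hc⟩, ⟨d, hd⟩⟩ := h4
  have ha' : ((M.1 0 0 : ℤ) : ℝ) = 4 * a + 1 := by
    have : M.1 0 0 = 4 * a + 1 := by omega
    exact_mod_cast this
  have hb' : ((M.1 0 1 : ℤ) : ℝ) = 2 * b := by exact_mod_cast hb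
  have hc' : ((M.1 1 0 : ℤ) : ℝ) = 4 * c := by exact_mod_cast hc
  have hd' : ((M.1 1 1 : ℤ) : ℝ) = 4 * d + 1 := by
    have : M.1 1 1 = 4 * d + 1 := by omega
    exact_mod_cast this
  refine ⟨n + ![2 * a - c, b - d], ?_⟩
  have hr : ∀ i j, (toReal M : Mat) i j = ((M.1 i j : ℤ) : ℝ) := fun i j => rfl
  ext i
  fin_cases i
  · simp [shift, hl, hn, toPlane, Matrix.vecMul, dotProduct, Fin.sum_univ_two, hr, ha', hc']
    ring
  · simp [shift, hl, hn, toPlane, Matrix.vecMul, dotProduct, Fin.sum_univ_two, hr, hb', hd']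
    ring

/-- The two-point function `R_f⁺`, the sum of `f (m₁ g, m₂ g)` over all `m₁ ≠ m₂` in `ℤ²`, as a
function of the coset `Λ g`. -/
def Rplus (f : Plane × Plane → ℝ) : Y → ℝ :=
  Quotient.lift (fun g => ∑' p, termPlus f g p) (by
    intro a b hab
    obtain ⟨γ, hγ, rfl⟩ := (rightRel_iff a b).1 hab
    obtain ⟨e, he⟩ := exists_equiv hγ
    have hs : ∀ p : Lattice × Lattice, p.1 ≠ p.2 ↔ (e.prodCongr e p).1 ≠ (e.prodCongr e p).2 :=
      fun p => by simp
    refine ((Equiv.subtypeEquiv (e.prodCongr e) hs).tsum_eq (termPlus f a)).symm.trans ?_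
    refine tsum_congr fun p => ?_
    simp [termPlus, act_mul, he])

/-- The two-point function `R_f⁻`, the sum of `f (m₁ g, -[m₂ (1, (1/2, -1/4)) g])` over all
`m₁`, `m₂` in `ℤ²`, as a function of the coset `Λ g`. -/
def Rminus (f : Plane × Plane → ℝ) : Y → ℝ :=
  Quotient.lift (fun g => ∑' p, termMinus f g p) (by
    intro a b hab
    obtain ⟨γ, hγ, rfl⟩ := (rightRel_iff a b).1 hab
    obtain ⟨e, he⟩ := exists_equiv hγ
    obtain ⟨d, hd⟩ := exists_equiv (shift_conj hγ)
    refine ((e.prodCongr d).tsum_eq (termMinus f a)).symm.trans ?_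
    refine tsum_congr fun p => ?_
    have h : shift * (γ * a) = (shift * γ * shift⁻¹) * (shift * a) := by group
    simp only [termMinus, h]
    rw [act_mul _ γ a, act_mul _ (shift * γ * shift⁻¹) (shift * a), he, hd]
    rfl)

end TwoPoint

end

open scoped ENNReal

noncomputable section

namespace TwoPoint

/-! Subtracting the first point from the second turns each two-point sum into a sum over pairs
(point, vector). With `g = (M, ξ)`, the point is `m₁g` and the vector is `(m₂ - m₁)M` in the plus
case, `(m₂ - m₁ + η)M` with `η = (1/2, -1/4)` in the minus case. So it suffices that the pairs
formed by a point of `ℤ²g` and a nonzero vector of `(ℤ² + η)M`, with `η` zero or the shift, have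
Lebesgue measure on `ℝ² × ℝ²` as total intensity (`IsLift.sum_map_pointVector`). A
measure-preserving shear, a sign, and Fubini then give the theorem for every integrable `f`.

The intensity is computed in two stages. Given `M`, translation invariance spreads the affine
lattice evenly, and its covolume is one, so its points have intensity one
(`IsLift.lintegral_tsum_act`). The vectors obey Siegel's mean value formula
(`IsLift.intensity_shiftedLattice`). Their intensity is invariant under `SL(2, ℝ)` and does not
charge the origin, so it is `c` times Lebesgue measure (`exists_eq_smul_volume`). To find `c`, a
bump function is dilated: for fixed `M` the normalized lattice sums are Riemann sums tending to its
integral, while their mean is always `c` times that integral. Dominated convergence gives `c = 1`.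

The dominating function is a count of short vectors of `ℤ²M`, and its mean must be shown finite. A
small square contains at most two primitive vectors `±v`, so primitive vectors have finite
intensity; summing over their multiples costs only the convergent series `∑ k⁻²`.

All of this uses only the invariance of `μ`, with no explicit Haar measure. A measurable section
carries `μ` to a probability measure on the group that still sees right invariance when tested on
left `Λ`-invariant functions (`isLift_map`). -/

namespace ASL

/-! ### Topology and Borel structure of the group -/

theorem isInducing_lin_trans : Topology.IsInducing (fun g : ASL => (g.lin, g.trans)) := ⟨rfl⟩

instance : SecondCountableTopology (SpecialLinearGroup (Fin 2) ℝ) :=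
  inferInstanceAs (SecondCountableTopology {A : Fin 2 → Fin 2 → ℝ // Matrix.det (Matrix.of A) = 1})

instance : SecondCountableTopology ASL :=
  TopologicalSpace.secondCountableTopology_induced _ _ _

theorem continuous_lin : Continuous ASL.lin :=
  continuous_fst.comp isInducing_lin_trans.continuous

theorem continuous_coe_lin : Continuous (fun g : ASL => (g.lin : Mat)) :=
  continuous_subtype_val.comp continuous_lin

theorem continuous_trans : Continuous ASL.trans :=
  continuous_snd.comp isInducing_lin_trans.continuous

instance : IsTopologicalGroup ASL where
  continuous_mul := isInducing_lin_trans.continuous_iff.2 <|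
    ((continuous_lin.comp continuous_fst).mul (continuous_lin.comp continuous_snd)).prodMk
      (((continuous_trans.comp continuous_fst).matrix_vecMul
        (continuous_coe_lin.comp continuous_snd)).add (continuous_trans.comp continuous_snd))
  continuous_inv := isInducing_lin_trans.continuous_iff.2 <|
    continuous_lin.inv.prodMk
      (continuous_trans.matrix_vecMul (continuous_subtype_val.comp continuous_lin.inv)).neg

instance : MeasurableSpace ASL := borel ASL

instance : BorelSpace ASL := ⟨rfl⟩

end ASL

/-! ### Discreteness of `Λ` and a measurable section of the quotient map -/

theorem coset_eq_iff (a b : ASL) : coset a = coset b ↔ ∃ γ ∈ Lam, b = γ * a :=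
  Quotient.eq.trans (rightRel_iff a b)

/-- The saturation of an open set is the union of its left translates by `Λ`. -/
theorem isOpenMap_coset : IsOpenMap coset := by
  intro U hU
  have : coset ⁻¹' (coset '' U) = ⋃ γ : Lam, (fun g => (γ : ASL) * g) '' U := by
    ext b
    simp only [Set.mem_preimage, Set.mem_image, Set.mem_iUnion, coset_eq_iff]
    constructor
    · rintro ⟨a, ha, γ, hγ, rfl⟩
      exact ⟨⟨γ, hγ⟩, a, ha, rfl⟩
    · rintro ⟨γ, a, ha, rfl⟩
      exact ⟨a, ha, γ, γ.2, rfl⟩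
  have h2 : IsOpen (coset ⁻¹' (coset '' U)) := by
    rw [this]
    exact isOpen_iUnion fun γ => isOpenMap_mul_left _ _ hU
  exact isOpen_coinduced.2 h2

/-- The open set of those `h` all of whose coordinates are within `1` of those of the identity. -/
def nearOne : Set ASL :=
  {h | (∀ i j, |(h.lin : Mat) i j - (1 : Mat) i j| < 1) ∧ ∀ i, |h.trans i| < 1}

theorem isOpen_nearOne : IsOpen nearOne := by
  have h1 : ∀ i j, IsOpen {h : ASL | |(h.lin : Mat) i j - (1 : Mat) i j| < 1} := fun i j =>
    isOpen_lt (((ASL.continuous_coe_lin.matrix_elem i j).sub continuous_const).abs)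
      continuous_const
  have h2 : ∀ i, IsOpen {h : ASL | |h.trans i| < 1} := fun i =>
    isOpen_lt (((continuous_apply i).comp ASL.continuous_trans).abs) continuous_const
  have : nearOne = (⋂ i, ⋂ j, {h : ASL | |(h.lin : Mat) i j - (1 : Mat) i j| < 1}) ∩
      ⋂ i, {h : ASL | |h.trans i| < 1} := by
    ext h
    simp [nearOne]
  rw [this]
  exact (isOpen_iInter_of_finite fun i => isOpen_iInter_of_finite (h1 i)).inter
    (isOpen_iInter_of_finite h2)

theorem eq_one_of_mem_nearOne {γ : ASL} (hγ : γ ∈ Lam) (h : γ ∈ nearOne) : γ = 1 := by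
  obtain ⟨⟨M, -, hM⟩, n, hn⟩ := hγ
  obtain ⟨h1, h2⟩ := h
  have hr : ∀ i j, (toReal M : Mat) i j = ((M.1 i j : ℤ) : ℝ) := fun i j => rfl
  ext i j
  · have := h1 i j
    rw [hM, hr] at this ⊢
    have hone : (1 : Mat) i j = (((1 : Matrix (Fin 2) (Fin 2) ℤ) i j : ℤ) : ℝ) := by
      simp [Matrix.one_apply]
    rw [hone] at this
    have h3 : |M.1 i j - (1 : Matrix (Fin 2) (Fin 2) ℤ) i j| < 1 := by exact_mod_cast this
    rw [Int.abs_lt_one_iff, sub_eq_zero] at h3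
    exact (congrArg Int.cast h3).trans hone.symm
  · have := h2 i
    rw [hn] at this ⊢
    have h3 : |n i| < 1 := by
      have h4 : |((n i : ℤ) : ℝ)| < 1 := this
      exact_mod_cast h4
    rw [Int.abs_lt_one_iff] at h3
    simp [toPlane, h3]

/-- Two points of one fibre differ by `γ = b * a⁻¹` in `Λ`; for `a`, `b` close to `g` this `γ` is
close to the identity, hence equal to it by discreteness. -/
theorem exists_nhds_injOn_coset (g : ASL) : ∃ U : Set ASL, IsOpen U ∧ g ∈ U ∧ Set.InjOn coset U := by
  have hc : Continuous fun p : ASL × ASL => p.2 * p.1⁻¹ :=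
    continuous_snd.mul continuous_fst.inv
  have hm : nearOne ∈ nhds ((fun p : ASL × ASL => p.2 * p.1⁻¹) (g, g)) := by
    apply isOpen_nearOne.mem_nhds
    simp [nearOne]
  have := hc.continuousAt.preimage_mem_nhds hm
  rw [nhds_prod_eq, Filter.mem_prod_same_iff] at this
  obtain ⟨V, hV, hVV⟩ := this
  obtain ⟨U, hUV, hU, hg⟩ := mem_nhds_iff.1 hV
  refine ⟨U, hU, hg, fun a ha b hb hab => ?_⟩
  obtain ⟨γ, hγ, rfl⟩ := (coset_eq_iff a b).1 hab
  have h1 : γ ∈ nearOne := by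
    have : (a, γ * a) ∈ V ×ˢ V := ⟨hUV ha, hUV hb⟩
    simpa using hVV this
  rw [eq_one_of_mem_nearOne hγ h1, one_mul]

/-- By second countability, countably many open sets on which `coset` is injective cover the group.
The section lifts `y` into the first of these sets that meets its fibre. -/
theorem exists_measurable_section : ∃ s : Y → ASL, Measurable s ∧ ∀ y, coset (s y) = y := by
  choose U hU hgU hinj using exists_nhds_injOn_coset
  obtain ⟨S, hS, hcov⟩ := TopologicalSpace.countable_cover_nhds fun g => (hU g).mem_nhds (hgU g)
  have hne : S.Nonempty := by
    by_contra h
    rw [Set.not_nonempty_iff_eq_empty] at h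
    have : (1 : ASL) ∈ ⋃ x ∈ S, U x := hcov ▸ Set.mem_univ _
    simp [h] at this
  obtain ⟨e, rfl⟩ := hS.exists_eq_range hne
  have hex : ∀ y, ∃ n, ∃ g ∈ U (e n), coset g = y := by
    intro y
    obtain ⟨g, rfl⟩ := Quotient.exists_rep y
    have : g ∈ ⋃ x ∈ Set.range e, U x := hcov ▸ Set.mem_univ _
    simp only [Set.mem_range, Set.iUnion_exists, Set.iUnion_iUnion_eq', Set.mem_iUnion] at this
    obtain ⟨n, hn⟩ := this
    exact ⟨n, g, hn, rfl⟩
  classical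
  let i : Y → ℕ := fun y => Nat.find (hex y)
  choose s hsU hs using fun y => Nat.find_spec (hex y)
  refine ⟨s, measurable_of_isOpen fun V hV => ?_, hs⟩
  -- The `n`-th piece consists of the cosets whose first usable chart is `U (e n)`; there `s`
  -- inverts the injective open map `coset`, so the preimage of `V` is a difference of open sets.
  have key : s ⁻¹' V = ⋃ n, (coset '' (U (e n) ∩ V)) \ ⋃ j < n, coset '' U (e j) := by
    ext y
    simp only [Set.mem_preimage, Set.mem_iUnion, Set.mem_sdiff, Set.mem_image, not_exists, exists_prop,
      not_and, Set.mem_inter_iff]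
    constructor
    · intro hy
      exact ⟨Nat.find (hex y), ⟨s y, ⟨hsU y, hy⟩, hs y⟩, fun j hj x hx hxy =>
        Nat.find_min (hex y) hj ⟨x, hx, hxy⟩⟩
    · rintro ⟨n, ⟨g, ⟨hgU', hgV⟩, hgy⟩, hmin⟩
      have hn : Nat.find (hex y) = n := by
        rw [Nat.find_eq_iff]
        exact ⟨⟨g, hgU', hgy⟩, fun j hj ⟨x, hx, hxy⟩ => hmin j hj x hx hxy⟩
      have : s y = g := hinj (e n) (hn ▸ hsU y) hgU' ((hs y).trans hgy.symm)
      rwa [this]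
  rw [key]
  exact MeasurableSet.iUnion fun n =>
    (isOpenMap_coset _ ((hU _).inter hV)).measurableSet.diff
      (MeasurableSet.iUnion fun j => MeasurableSet.iUnion fun _ =>
        (isOpenMap_coset _ (hU _)).measurableSet)

/-! ### Lifting the invariant measure to the group -/

theorem measurable_translate (h : ASL) : Measurable (translate h) := by
  refine Continuous.measurable ?_
  exact (continuous_id.mul continuous_const : Continuous fun g : ASL => g * h).quotient_map' _

/-- A probability measure on the group for which right translations preserve the integrals of
all left `Λ`-invariant functions. -/
structure IsLift (P : Measure ASL) : Prop where
  prob : IsProbabilityMeasure P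
  lintegral_mul_right : ∀ Φ : ASL → ENNReal, Measurable Φ → (∀ γ ∈ Lam, ∀ g, Φ (γ * g) = Φ g) →
    ∀ h, ∫⁻ g, Φ (g * h) ∂P = ∫⁻ g, Φ g ∂P

/-- A left `Λ`-invariant function factors through `Y`, and `s y * h` and `s (translate h y)` lie in
the same coset. Invariance of `μ` therefore transfers, although `μ.map s` itself need not be right
invariant. -/
theorem isLift_map {μ : Measure Y} (hμ : IsInvariantProbability μ) {s : Y → ASL}
    (hs : Measurable s) (hsec : ∀ y, coset (s y) = y) : IsLift (μ.map s) := by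
  have := hμ.prob
  refine ⟨Measure.isProbabilityMeasure_map hs.aemeasurable, fun Φ hΦ hinv h => ?_⟩
  have hΦs : ∀ g, Φ (s (coset g)) = Φ g := by
    intro g
    obtain ⟨γ, hγ, he⟩ := (coset_eq_iff _ _).1 (hsec (coset g))
    exact (hinv γ hγ _).symm.trans (congrArg Φ he.symm)
  have hmeas : Measurable fun g : ASL => g * h :=
    (continuous_id.mul continuous_const : Continuous fun g : ASL => g * h).measurable
  rw [lintegral_map (f := fun g => Φ (g * h)) (hΦ.comp hmeas) hs, lintegral_map hΦ hs]
  have h1 : ∀ y, Φ (s y * h) = Φ (s (translate h y)) := by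
    intro y
    have : translate h y = coset (s y * h) := by
      conv_lhs => rw [← hsec y]
      rfl
    rw [this, hΦs]
  simp_rw [h1]
  rw [← lintegral_map (f := fun y => Φ (s y)) (hΦ.comp hs) (measurable_translate h), hμ.invariant]

/-! ### Shear-invariant measures on the plane -/

theorem lintegral_comp_sub_mul (k : ℝ → ℝ≥0∞) (hk : Measurable k) {a : ℝ} (ha : a ≠ 0) (b : ℝ) :
    ∫⁻ t, k (b - t * a) = ENNReal.ofReal |a⁻¹| * ∫⁻ s, k s := by
  have h1 : ∫⁻ t, k (b - t) = ∫⁻ s, k s := lintegral_sub_left_eq_self _ _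
  have hm : Measurable fun t => k (b - t) := hk.comp (measurable_const.sub measurable_id)
  rw [← h1, ← lintegral_map (f := fun t => k (b - t)) hm (measurable_mul_const a),
    Real.map_volume_mul_right ha, lintegral_smul_measure, smul_eq_mul]

/-- A measure on the plane that is invariant under vertical shears is, off the vertical axis, a
product of some measure with Lebesgue measure. -/
theorem exists_disintegration_of_shear (ν : Measure (ℝ × ℝ)) [SFinite ν]
    (hν : ∀ t : ℝ, ν.map (fun p => (p.1, p.2 + t * p.1)) = ν) :
    ∃ σ : Measure ℝ, σ {0} = 0 ∧ ∀ H : ℝ × ℝ → ℝ≥0∞, Measurable H →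
      ∫⁻ p in {p | p.1 ≠ 0}, H p ∂ν = ∫⁻ a, (∫⁻ s, H (a, s)) ∂σ := by
  have hne : MeasurableSet {p : ℝ × ℝ | p.1 ≠ 0} :=
    (measurable_fst (measurableSet_singleton (0 : ℝ))).compl
  -- Any probability density would do. It is inserted as `∫ φ (p.2 / p.1 + t) dt = 1`; shearing by
  -- `-t` moves the parameter from `φ` to `H`, and integrating over `t` produces Lebesgue measure on
  -- the vertical line with Jacobian `|p.1⁻¹|`, which is built into `w`.
  let φ : ℝ → ℝ≥0∞ := (Set.Icc (0 : ℝ) 1).indicator 1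
  have hφ : Measurable φ := measurable_one.indicator measurableSet_Icc
  have hφ1 : ∫⁻ t, φ t = 1 := by
    rw [lintegral_indicator_one measurableSet_Icc]
    simp
  let w : ℝ × ℝ → ℝ≥0∞ := fun p => φ (p.2 / p.1) * ENNReal.ofReal |p.1⁻¹|
  have hw : Measurable w := by fun_prop
  refine ⟨((ν.restrict {p | p.1 ≠ 0}).withDensity w).map Prod.fst, ?_, fun H hH => ?_⟩
  · rw [Measure.map_apply measurable_fst (measurableSet_singleton 0),
      withDensity_apply _ (measurable_fst (measurableSet_singleton 0)), Measure.restrict_restrict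
        (measurable_fst (measurableSet_singleton 0))]
    have : Prod.fst ⁻¹' {(0 : ℝ)} ∩ {p : ℝ × ℝ | p.1 ≠ 0} = ∅ := by
      ext p
      simp
    rw [this]
    simp
  · have hI : Measurable fun a => ∫⁻ s, H (a, s) := hH.lintegral_prod_right'
    rw [lintegral_map hI measurable_fst, lintegral_withDensity_eq_lintegral_mul _ hw
      (g := fun p => ∫⁻ s, H (p.1, s)) (hI.comp measurable_fst)]
    have step1 : ∫⁻ p in {p | p.1 ≠ 0}, H p ∂ν
        = ∫⁻ p in {p | p.1 ≠ 0}, (∫⁻ t, H p * φ (p.2 / p.1 + t)) ∂ν := by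
      refine lintegral_congr fun p => ?_
      rw [lintegral_const_mul _ (by fun_prop), lintegral_add_left_eq_self, hφ1, mul_one]
    have hmeas1 : Measurable fun q : (ℝ × ℝ) × ℝ => H q.1 * φ (q.1.2 / q.1.1 + q.2) := by
      fun_prop
    have hmeas2 : Measurable fun q : (ℝ × ℝ) × ℝ =>
        φ (q.1.2 / q.1.1) * H (q.1.1, q.1.2 - q.2 * q.1.1) := by
      fun_prop
    have step2 : ∀ t : ℝ, ∫⁻ p in {p | p.1 ≠ 0}, H p * φ (p.2 / p.1 + t) ∂ν
        = ∫⁻ p in {p | p.1 ≠ 0}, φ (p.2 / p.1) * H (p.1, p.2 - t * p.1) ∂ν := by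
      intro t
      rw [← lintegral_indicator hne, ← lintegral_indicator hne]
      conv_lhs => rw [← hν (-t)]
      rw [lintegral_map (Measurable.indicator (by fun_prop) hne) (by fun_prop)]
      refine lintegral_congr fun p => ?_
      by_cases hp : p.1 = 0
      · rw [Set.indicator_of_notMem (by simpa using hp), Set.indicator_of_notMem (by simpa using hp)]
      · rw [Set.indicator_of_mem (by simpa using hp), Set.indicator_of_mem (by simpa using hp),
          mul_comm]
        congr 2
        · field_simp
          ring
        · congr 1
          ring
    rw [step1, lintegral_lintegral_swap hmeas1.aemeasurable]
    simp_rw [step2]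
    rw [← lintegral_lintegral_swap hmeas2.aemeasurable]
    refine setLIntegral_congr_fun hne fun p hp => ?_
    have hk : Measurable fun s => H (p.1, s) := by fun_prop
    rw [lintegral_const_mul _ (by fun_prop), lintegral_comp_sub_mul _ hk hp]
    simp [w, mul_assoc]

/-- Vertical shears give a product `σ × Lebesgue` off the vertical axis, horizontal shears a product
`Lebesgue × τ` off the horizontal one. Comparing both on `E × [1, 2]` shows that `σ` is a multiple
of Lebesgue measure. -/
theorem eq_smul_volume_of_shear_invariant (ν : Measure (ℝ × ℝ)) [SFinite ν] (h0 : ν {0} = 0)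
    (hu : ∀ t : ℝ, ν.map (fun p => (p.1, p.2 + t * p.1)) = ν)
    (hl : ∀ t : ℝ, ν.map (fun p => (p.1 + t * p.2, p.2)) = ν) :
    ∃ c : ℝ≥0∞, ν = c • volume := by
  obtain ⟨σ, hσ0, hσ⟩ := exists_disintegration_of_shear ν hu
  obtain ⟨τ, -, hτ⟩ := exists_disintegration_of_shear (ν.map Prod.swap) (by
    intro t
    conv_rhs => rw [← hl t]
    rw [Measure.map_map (by fun_prop) measurable_swap, Measure.map_map measurable_swap (by fun_prop)]
    rfl)
  have hne1 : MeasurableSet {p : ℝ × ℝ | p.1 ≠ 0} :=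
    (measurable_fst (measurableSet_singleton (0 : ℝ))).compl
  have hne2 : MeasurableSet {p : ℝ × ℝ | p.2 ≠ 0} :=
    (measurable_snd (measurableSet_singleton (0 : ℝ))).compl
  have hτ' : ∀ H : ℝ × ℝ → ℝ≥0∞, Measurable H →
      ∫⁻ p in {p | p.2 ≠ 0}, H p ∂ν = ∫⁻ b, (∫⁻ s, H (s, b)) ∂τ := by
    intro H hH
    have := hτ (fun p => H p.swap) (hH.comp measurable_swap)
    rw [setLIntegral_map (f := fun p => H p.swap) hne1 (by fun_prop) measurable_swap] at this
    simpa using this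
  have hset : ∀ B : Set (ℝ × ℝ), MeasurableSet B →
      ν (B ∩ {p | p.1 ≠ 0}) = ∫⁻ a, volume (Prod.mk a ⁻¹' B) ∂σ := by
    intro B hB
    have := hσ (B.indicator 1) (measurable_one.indicator hB)
    rw [lintegral_indicator_one hB, Measure.restrict_apply hB] at this
    rw [this]
    refine lintegral_congr fun a => ?_
    exact lintegral_indicator_one (measurable_prodMk_left hB)
  have hset' : ∀ B : Set (ℝ × ℝ), MeasurableSet B →
      ν (B ∩ {p | p.2 ≠ 0}) = ∫⁻ b, volume ((fun s => (s, b)) ⁻¹' B) ∂τ := by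
    intro B hB
    have := hτ' (B.indicator 1) (measurable_one.indicator hB)
    rw [lintegral_indicator_one hB, Measure.restrict_apply hB] at this
    rw [this]
    refine lintegral_congr fun b => ?_
    exact lintegral_indicator_one (measurable_prodMk_right hB)
  -- The interval `[1, 2]` is chosen for its unit length and because it avoids `0`, so that the
  -- rectangles miss the horizontal axis.
  have hI : volume (Set.Icc (1 : ℝ) 2) = 1 := by simp; norm_num
  have hrect : ∀ E : Set ℝ, MeasurableSet E → (0 : ℝ) ∉ E →
      σ E = τ (Set.Icc 1 2) * volume E := by
    intro E hE hE0
    have hB : MeasurableSet (E ×ˢ Set.Icc (1 : ℝ) 2) := hE.prod measurableSet_Icc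
    have e1 := hset _ hB
    have e2 := hset' _ hB
    have s1 : E ×ˢ Set.Icc (1 : ℝ) 2 ∩ {p | p.1 ≠ 0} = E ×ˢ Set.Icc (1 : ℝ) 2 := by
      refine Set.inter_eq_left.2 fun p hp h => hE0 ?_
      rw [← h]
      exact hp.1
    have s2 : E ×ˢ Set.Icc (1 : ℝ) 2 ∩ {p | p.2 ≠ 0} = E ×ˢ Set.Icc (1 : ℝ) 2 := by
      refine Set.inter_eq_left.2 fun p hp h => ?_
      have := hp.2.1
      rw [h] at this
      linarith
    rw [s1] at e1
    rw [s2, e1] at e2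
    have l1 : ∀ a, volume (Prod.mk a ⁻¹' (E ×ˢ Set.Icc (1 : ℝ) 2)) = E.indicator 1 a := by
      intro a
      by_cases ha : a ∈ E
      · rw [Set.mk_preimage_prod_right ha, hI, Set.indicator_of_mem ha, Pi.one_apply]
      · rw [Set.mk_preimage_prod_right_eq_empty ha, Set.indicator_of_notMem ha, measure_empty]
    have l2 : ∀ b, volume ((fun s => (s, b)) ⁻¹' (E ×ˢ Set.Icc (1 : ℝ) 2))
        = (Set.Icc (1 : ℝ) 2).indicator (fun _ => volume E) b := by
      intro b
      by_cases hb : b ∈ Set.Icc (1 : ℝ) 2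
      · rw [Set.mk_preimage_prod_left hb, Set.indicator_of_mem hb]
      · rw [Set.mk_preimage_prod_left_eq_empty hb, Set.indicator_of_notMem hb, measure_empty]
    simp_rw [l1, l2] at e2
    rw [lintegral_indicator_one hE, lintegral_indicator_const measurableSet_Icc] at e2
    rw [e2, mul_comm]
  have hσv : σ = τ (Set.Icc 1 2) • volume := by
    ext E hE
    have hd : σ E = σ (E \ {0}) := (measure_sdiff_null hσ0).symm
    have hd' : (volume : Measure ℝ) E = volume (E \ {0}) :=
      (measure_sdiff_null (by simp)).symm
    rw [hd, hrect _ (hE.diff (measurableSet_singleton 0)) (by simp), ← hd']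
    rfl
  -- The first disintegration says nothing about the vertical axis. The second does: each horizontal
  -- line meets it in one point, and the origin is null by hypothesis.
  have haxis : ν {p | p.1 = 0} = 0 := by
    have hB : MeasurableSet {p : ℝ × ℝ | p.1 = 0} := measurable_fst (measurableSet_singleton (0 : ℝ))
    have e := hset' _ hB
    have : ∀ b : ℝ, volume ((fun s => (s, b)) ⁻¹' {p : ℝ × ℝ | p.1 = 0}) = 0 := by
      intro b
      have : (fun s : ℝ => (s, b)) ⁻¹' {p : ℝ × ℝ | p.1 = 0} = {0} := by
        ext s
        simp
      rw [this]
      simp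
    simp_rw [this, lintegral_zero] at e
    refine measure_mono_null (t := ({p : ℝ × ℝ | p.1 = 0} ∩ {p | p.2 ≠ 0}) ∪ {0}) ?_
      (measure_union_null e h0)
    intro p hp
    by_cases h2 : p.2 = 0
    · exact Or.inr (Prod.ext hp h2)
    · exact Or.inl ⟨hp, h2⟩
  refine ⟨τ (Set.Icc 1 2), ?_⟩
  ext B hB
  have h1 : ν B = ν (B ∩ {p | p.1 ≠ 0}) := by
    refine le_antisymm ?_ (measure_mono Set.inter_subset_left)
    calc ν B ≤ ν ((B ∩ {p | p.1 ≠ 0}) ∪ {p | p.1 = 0}) := by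
          refine measure_mono fun p hp => ?_
          by_cases h : p.1 = 0
          · exact Or.inr h
          · exact Or.inl ⟨hp, h⟩
      _ ≤ _ := measure_union_le _ _
      _ = _ := by rw [haxis, add_zero]
  rw [h1, hset B hB, hσv, lintegral_smul_measure, Measure.volume_eq_prod, Measure.smul_apply,
    Measure.prod_apply hB]

/-- A measure on the plane that is invariant under `SL(2, ℝ)` and does not charge the origin is a
multiple of Lebesgue measure. -/
theorem exists_eq_smul_volume (ν : Measure Plane) [SFinite ν] (h0 : ν {0} = 0)
    (hν : ∀ M : SpecialLinearGroup (Fin 2) ℝ, ν.map (fun v => v ᵥ* (M : Mat)) = ν) :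
    ∃ c : ℝ≥0∞, ν = c • volume := by
  let e : Plane ≃ᵐ ℝ × ℝ := MeasurableEquiv.finTwoArrow
  have he : ∀ v : Plane, e v = (v 0, v 1) := fun v => rfl
  have key : ∀ (M : SpecialLinearGroup (Fin 2) ℝ) (T : ℝ × ℝ → ℝ × ℝ), Measurable T →
      (∀ v, T (e v) = e (v ᵥ* (M : Mat))) → (ν.map e).map T = ν.map e := by
    intro M T hT h
    have hM : Measurable fun v : Plane => v ᵥ* (M : Mat) :=
      (continuous_id.matrix_vecMul continuous_const).measurable
    conv_rhs => rw [← hν M]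
    rw [Measure.map_map hT e.measurable, Measure.map_map e.measurable hM]
    congr 1
    exact funext h
  obtain ⟨c, hc⟩ := eq_smul_volume_of_shear_invariant (ν.map e) (by
      rw [e.map_apply]
      convert h0
      ext v
      simp only [Set.mem_preimage, he, Set.mem_singleton_iff, Prod.mk_eq_zero]
      constructor
      · rintro ⟨h, h'⟩
        ext i
        fin_cases i <;> assumption
      · rintro rfl
        exact ⟨rfl, rfl⟩)
    (fun t => key ⟨!![1, t; 0, 1], by simp [Matrix.det_fin_two]⟩ _ (by fun_prop) fun v => by
      simp [he, vecHead, vecTail]; ring)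
    (fun t => key ⟨!![1, 0; t, 1], by simp [Matrix.det_fin_two]⟩ _ (by fun_prop) fun v => by
      simp [he, vecHead, vecTail]; ring)
  refine ⟨c, ?_⟩
  have h2 : (ν.map e).map e.symm = ν := by
    rw [Measure.map_map e.symm.measurable e.measurable]
    simp
  rw [← h2, hc, Measure.map_smul]
  congr 1
  exact (volume_preserving_finTwoArrow ℝ).symm.map_eq

/-! ### Measurability of the action and unfolding over unit squares -/

theorem continuous_act (x : Plane) : Continuous (act x) :=
  (continuous_const.matrix_vecMul ASL.continuous_coe_lin).add ASL.continuous_trans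

theorem measurable_act (x : Plane) : Measurable (act x) := (continuous_act x).measurable

theorem measurable_vecMul_lin (v : Plane) : Measurable fun g : ASL => v ᵥ* (g.lin : Mat) :=
  (continuous_const.matrix_vecMul ASL.continuous_coe_lin).measurable

theorem measurable_vecMul (M : Mat) : Measurable fun v : Plane => v ᵥ* M :=
  (continuous_id.matrix_vecMul continuous_const).measurable

/-- The unit square with lower left corner `m`. -/
def square (m : Lattice) : Set Plane := Set.univ.pi fun i => Set.Ico (m i : ℝ) (m i + 1)

theorem mem_square {m : Lattice} {x : Plane} : x ∈ square m ↔ ∀ i, ⌊x i⌋ = m i := by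
  simp [square, Int.floor_eq_iff]

theorem measurableSet_square (m : Lattice) : MeasurableSet (square m) :=
  MeasurableSet.univ_pi fun _ => measurableSet_Ico

theorem volume_square (m : Lattice) : volume (square m) = 1 := by
  simp [square, volume_pi_pi]

theorem iUnion_square : ⋃ m, square m = Set.univ := by
  ext x
  simp only [Set.mem_iUnion, Set.mem_univ, iff_true]
  exact ⟨fun i => ⌊x i⌋, mem_square.2 fun _ => rfl⟩

theorem pairwise_disjoint_square : Pairwise (Function.onFun Disjoint square) := by
  intro m n hmn
  refine Set.disjoint_left.2 fun x hm hn => hmn ?_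
  ext i
  rw [← mem_square.1 hm, mem_square.1 hn]

theorem lintegral_eq_tsum_square (h : Plane → ℝ≥0∞) :
    ∫⁻ x, h x = ∑' m, ∫⁻ x in square m, h x := by
  rw [← setLIntegral_univ, ← iUnion_square, lintegral_iUnion measurableSet_square
    pairwise_disjoint_square]

theorem lintegral_square (h : Plane → ℝ≥0∞) (m : Lattice) :
    ∫⁻ x in square m, h x = ∫⁻ x in square 0, h (x + toPlane m) := by
  rw [← lintegral_indicator (measurableSet_square m), ← lintegral_indicator (measurableSet_square 0),
    ← lintegral_add_right_eq_self _ (toPlane m)]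
  refine lintegral_congr fun x => ?_
  have : x + toPlane m ∈ square m ↔ x ∈ square 0 := by
    simp [mem_square, toPlane]
  by_cases hx : x ∈ square 0
  · rw [Set.indicator_of_mem hx, Set.indicator_of_mem (this.2 hx)]
  · rw [Set.indicator_of_notMem hx, Set.indicator_of_notMem (mt this.1 hx)]

theorem lintegral_eq_lintegral_tsum (h : Plane → ℝ≥0∞) (hh : Measurable h) :
    ∫⁻ x, h x = ∫⁻ x in square 0, ∑' m, h (x + toPlane m) := by
  rw [lintegral_eq_tsum_square, lintegral_tsum fun m => by fun_prop]
  exact tsum_congr fun m => lintegral_square h m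

theorem measurePreserving_vecMul (M : SpecialLinearGroup (Fin 2) ℝ) :
    MeasurePreserving (fun v : Plane => v ᵥ* (M : Mat)) volume volume := by
  refine ⟨measurable_vecMul _, ?_⟩
  have hd : ((M : Mat)ᵀ).det = 1 := by rw [det_transpose, M.2]
  have := Real.map_matrix_volume_pi_eq_smul_volume_pi (M := (M : Mat)ᵀ) (by simp [hd])
  rw [hd] at this
  have h2 : (fun v : Plane => v ᵥ* (M : Mat)) = toLin' (M : Mat)ᵀ := by
    ext v
    simp [Matrix.mulVec_transpose]
  rw [h2, this]
  simp

theorem lintegral_vecMul (M : SpecialLinearGroup (Fin 2) ℝ) (h : Plane → ℝ≥0∞) (hh : Measurable h) :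
    ∫⁻ v, h (v ᵥ* (M : Mat)) = ∫⁻ v, h v :=
  (measurePreserving_vecMul M).lintegral_comp hh

/-- The permutation of `ℤ²` given by an element of `SL(2, ℤ)`. -/
def latticeEquiv (γ : SpecialLinearGroup (Fin 2) ℤ) : Lattice ≃ Lattice where
  toFun m := m ᵥ* γ.1
  invFun m := m ᵥ* (γ⁻¹).1
  left_inv m := by
    have : γ.1 * (γ⁻¹).1 = 1 := congrArg Subtype.val (mul_inv_cancel γ)
    simp only [Matrix.vecMul_vecMul, this, Matrix.vecMul_one]
  right_inv m := by
    have : (γ⁻¹).1 * γ.1 = 1 := congrArg Subtype.val (inv_mul_cancel γ)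
    simp only [Matrix.vecMul_vecMul, this, Matrix.vecMul_one]

/-! ### Periodizations and lattice partitions of unity -/

/-- The periodization of `p` with respect to the lattice `ℤ² M`. -/
def periodization (p : Plane → ℝ≥0∞) (M : SpecialLinearGroup (Fin 2) ℝ) (t : Plane) : ℝ≥0∞ :=
  ∑' m, p (t + toPlane m ᵥ* (M : Mat))

section periodization

variable {p : Plane → ℝ≥0∞}

theorem measurable_periodization (hp : Measurable p) :
    Measurable fun q : ASL × Plane => periodization p q.1.lin q.2 := by
  refine Measurable.tsum fun m => hp.comp ?_
  exact measurable_snd.add ((measurable_vecMul_lin _).comp measurable_fst)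

theorem measurable_periodization_right (hp : Measurable p) (M : SpecialLinearGroup (Fin 2) ℝ) :
    Measurable (periodization p M) :=
  Measurable.tsum fun _ => hp.comp (measurable_id.add_const _)

theorem periodization_add (M : SpecialLinearGroup (Fin 2) ℝ) (t : Plane) (n : Lattice) :
    periodization p M (t + toPlane n ᵥ* (M : Mat)) = periodization p M t := by
  unfold periodization
  rw [← (Equiv.addLeft n).tsum_eq fun m => p (t + toPlane m ᵥ* (M : Mat))]
  refine tsum_congr fun m => ?_
  rw [Equiv.coe_addLeft, toPlane_add, Matrix.add_vecMul, add_assoc]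

theorem periodization_mul (γ : SpecialLinearGroup (Fin 2) ℤ) (M : SpecialLinearGroup (Fin 2) ℝ)
    (t : Plane) : periodization p (toReal γ * M) t = periodization p M t := by
  unfold periodization
  rw [← (latticeEquiv γ).tsum_eq fun m => p (t + toPlane m ᵥ* (M : Mat))]
  refine tsum_congr fun m => ?_
  congr 2
  exact (Matrix.vecMul_vecMul _ _ _).symm.trans (congrArg (· ᵥ* (M : Mat)) (toPlane_vecMul m γ))

theorem periodization_ne_zero (hpos : ∀ x, p x ≠ 0) (M : SpecialLinearGroup (Fin 2) ℝ) (t : Plane) :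
    periodization p M t ≠ 0 := by
  intro h
  exact hpos _ (ENNReal.tsum_eq_zero.1 h 0)

theorem lintegral_periodization (hp : Measurable p) (M : SpecialLinearGroup (Fin 2) ℝ) :
    ∫⁻ x in square 0, periodization p M (x ᵥ* (M : Mat)) = ∫⁻ x, p x := by
  rw [← lintegral_vecMul M p hp,
    lintegral_eq_lintegral_tsum (fun v => p (v ᵥ* (M : Mat))) (hp.comp (measurable_vecMul _))]
  simp_rw [Matrix.add_vecMul]
  rfl

/-- Finiteness of the integral gives the claim almost everywhere on a fundamental domain. The
exceptional set is lattice periodic, so the periodization of its indicator vanishes almost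
everywhere on that domain, and unfolding makes the set null. -/
theorem ae_periodization_ne_top (hp : Measurable p) (hint : ∫⁻ x, p x ≠ ∞)
    (M : SpecialLinearGroup (Fin 2) ℝ) : ∀ᵐ t, periodization p M t ≠ ∞ := by
  have hmeas := measurable_periodization_right hp M
  have hZ : MeasurableSet {t | periodization p M t = ∞} := hmeas (measurableSet_singleton ∞)
  have h1 : ∀ᵐ x ∂volume.restrict (square 0), periodization p M (x ᵥ* (M : Mat)) < ∞ := by
    refine ae_lt_top (hmeas.comp (measurable_vecMul _)) ?_
    rwa [lintegral_periodization hp]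
  change volume {t | ¬ (periodization p M t ≠ ∞)} = 0
  simp only [ne_eq, not_not]
  rw [← lintegral_indicator_one hZ, ← lintegral_periodization (measurable_one.indicator hZ) M,
    lintegral_eq_zero_iff']
  · filter_upwards [h1] with x hx
    refine ENNReal.tsum_eq_zero.2 fun m => Set.indicator_of_notMem (fun hm => hx.ne ?_) _
    rwa [← periodization_add M _ m]
  · exact ((measurable_periodization_right (measurable_one.indicator hZ) M).comp
      (measurable_vecMul _)).aemeasurable

/-- The partition of unity obtained from `p` by dividing by its periodization. -/
def weight (p : Plane → ℝ≥0∞) (M : SpecialLinearGroup (Fin 2) ℝ) (t : Plane) : ℝ≥0∞ :=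
  p t / periodization p M t

theorem measurable_weight (hp : Measurable p) :
    Measurable fun q : ASL × Plane => weight p q.1.lin q.2 :=
  (hp.comp measurable_snd).div (measurable_periodization hp)

theorem measurable_weight_right (hp : Measurable p) (M : SpecialLinearGroup (Fin 2) ℝ) :
    Measurable (weight p M) :=
  hp.div (measurable_periodization_right hp M)

theorem periodization_weight (hpos : ∀ x, p x ≠ 0) {M : SpecialLinearGroup (Fin 2) ℝ} {t : Plane}
    (h : periodization p M t ≠ ∞) : periodization (weight p M) M t = 1 := by
  unfold periodization weight
  simp_rw [periodization_add, div_eq_mul_inv]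
  rw [ENNReal.tsum_mul_right]
  exact ENNReal.mul_inv_cancel (periodization_ne_zero hpos M t) h

theorem ae_periodization_weight (hp : Measurable p) (hpos : ∀ x, p x ≠ 0) (hint : ∫⁻ x, p x ≠ ∞)
    (M : SpecialLinearGroup (Fin 2) ℝ) : ∀ᵐ t, periodization (weight p M) M t = 1 := by
  filter_upwards [ae_periodization_ne_top hp hint M] with t ht
  exact periodization_weight hpos ht

theorem lintegral_weight (hp : Measurable p) (hpos : ∀ x, p x ≠ 0) (hint : ∫⁻ x, p x ≠ ∞)
    (M : SpecialLinearGroup (Fin 2) ℝ) : ∫⁻ t, weight p M t = 1 := by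
  rw [← lintegral_periodization (measurable_weight_right hp M) M]
  have h1 : ∀ᵐ x : Plane, periodization (weight p M) M (x ᵥ* (M : Mat)) = 1 :=
    (measurePreserving_vecMul M).quasiMeasurePreserving.ae
      (ae_periodization_weight hp hpos hint M)
  rw [lintegral_congr_ae (ae_restrict_of_ae h1), lintegral_one, Measure.restrict_apply_univ,
    volume_square]

end periodization

/-! ### Intensity of the affine lattice points -/

/-- Given the lattice `ℤ² M`, the points of the affine lattice `ℤ² (M, ξ)` have intensity one. -/
theorem IsLift.lintegral_tsum_act {P : Measure ASL} (hP : IsLift P) (H : ASL → Plane → ℝ≥0∞)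
    (hH : Measurable fun q : ASL × Plane => H q.1 q.2)
    (hlin : ∀ g h : ASL, g.lin = h.lin → H g = H h) (hΛ : ∀ γ ∈ Lam, ∀ g, H (γ * g) = H g) :
    ∫⁻ g, ∑' m, H g (act (toPlane m) g) ∂P = ∫⁻ g, (∫⁻ u, H g u) ∂P := by
  have := hP.prob
  -- Positivity of `p` keeps its periodization away from `0` and the finite integral keeps it almost
  -- everywhere below `∞`, so the quotient `weight` is a genuine partition of unity.
  obtain ⟨p', hpos', hp', hint'⟩ :=
    exists_pos_lintegral_lt_of_sigmaFinite (volume : Measure Plane) one_ne_zero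
  let p : Plane → ℝ≥0∞ := fun x => p' x
  have hp : Measurable p := hp'.coe_nnreal_ennreal
  have hpos : ∀ x, p x ≠ 0 := fun x => by simpa [p] using (hpos' x).ne'
  have hint : ∫⁻ x, p x ≠ ∞ := (hint'.trans ENNReal.one_lt_top).ne
  have hact : ∀ m, Measurable fun q : ASL × Plane => act (toPlane m) q.1 := fun m =>
    (measurable_act _).comp measurable_fst
  have hHm : ∀ m, Measurable fun q : ASL × Plane => H q.1 (act (toPlane m) q.1) := fun m =>
    hH.comp (measurable_fst.prodMk (hact m))
  have hHm' : ∀ m, Measurable fun q : ASL × Plane => H q.1 (act (toPlane m) q.1 - q.2) := fun m =>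
    hH.comp (measurable_fst.prodMk ((hact m).sub measurable_snd))
  have hw := measurable_weight hp
  have hm1 : Measurable fun q : ASL × Plane =>
      ∑' m, H q.1 (act (toPlane m) q.1) * weight p q.1.lin q.2 :=
    Measurable.tsum fun m => (hHm m).mul hw
  have hm2 : Measurable fun q : ASL × Plane =>
      ∑' m, H q.1 (act (toPlane m) q.1 - q.2) * weight p q.1.lin q.2 :=
    Measurable.tsum fun m => (hHm' m).mul hw
  have step1 : ∫⁻ g, ∑' m, H g (act (toPlane m) g) ∂P
      = ∫⁻ g, (∫⁻ t, ∑' m, H g (act (toPlane m) g) * weight p g.lin t) ∂P := by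
    refine lintegral_congr fun g => ?_
    simp_rw [ENNReal.tsum_mul_right]
    rw [lintegral_const_mul _ (measurable_weight_right hp _), lintegral_weight hp hpos hint, mul_one]
  -- Right translation by `(1, -t)` fixes the lattice and moves every point by `-t`; `hlin` and `hΛ`
  -- make the sum eligible for the lifted invariance.
  have step2 : ∀ t : Plane, ∫⁻ g, ∑' m, H g (act (toPlane m) g) * weight p g.lin t ∂P
      = ∫⁻ g, ∑' m, H g (act (toPlane m) g - t) * weight p g.lin t ∂P := by
    intro t
    rw [← hP.lintegral_mul_right (fun g => ∑' m, H g (act (toPlane m) g) * weight p g.lin t)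
      (hm1.comp (measurable_id.prodMk measurable_const)) ?_ ⟨1, -t⟩]
    · refine lintegral_congr fun g => tsum_congr fun m => ?_
      have e1 : (g * ⟨1, -t⟩ : ASL).lin = g.lin := by simp
      rw [hlin _ g e1, e1, act_mul]
      congr 2
      simp [act, sub_eq_add_neg]
    · intro γ hγ g
      obtain ⟨e, he⟩ := exists_equiv hγ
      obtain ⟨⟨A, -, hA⟩, -⟩ := id hγ
      rw [← e.tsum_eq fun m => H g (act (toPlane m) g) * weight p g.lin t]
      refine tsum_congr fun m => ?_
      rw [hΛ γ hγ, act_mul, he, ASL.mul_lin, hA]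
      simp only [weight, periodization_mul]
  -- Substituting `u = act (toPlane m) g - t` frees `H` from `m`; the weights left over sum to one
  -- over the lattice.
  have step3 : ∀ g : ASL, ∫⁻ t, ∑' m, H g (act (toPlane m) g - t) * weight p g.lin t
      = ∫⁻ u, H g u := by
    intro g
    have hg : Measurable (H g) := hH.comp measurable_prodMk_left
    have hwg := measurable_weight_right hp g.lin
    have e1 : ∀ m, ∫⁻ t, H g (act (toPlane m) g - t) * weight p g.lin t
        = ∫⁻ u, H g u * weight p g.lin (act (toPlane m) g - u) := by
      intro m
      rw [← lintegral_sub_left_eq_self _ (act (toPlane m) g)]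
      simp
    rw [lintegral_tsum fun m => by fun_prop, tsum_congr e1,
      ← lintegral_tsum fun m => by fun_prop]
    have hae : ∀ᵐ u : Plane, periodization (weight p g.lin) g.lin (g.trans - u) = 1 :=
      (quasiMeasurePreserving_sub_left volume g.trans).ae
        (ae_periodization_weight hp hpos hint g.lin)
    refine lintegral_congr_ae ?_
    filter_upwards [hae] with u hu
    rw [ENNReal.tsum_mul_left]
    conv_rhs => rw [← mul_one (H g u), ← hu]
    congr 1
    refine tsum_congr fun m => ?_
    congr 1
    simp only [act]
    abel
  rw [step1, lintegral_lintegral_swap hm1.aemeasurable]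
  simp_rw [step2]
  rw [← lintegral_lintegral_swap hm2.aemeasurable]
  simp_rw [step3]

/-! ### Intensities of stable sets of vectors -/

theorem lintegral_comp_smul {r : ℝ} (hr : r ≠ 0) (h : Plane → ℝ≥0∞) (hh : Measurable h) :
    ∫⁻ x, h (r • x) = ENNReal.ofReal (r ^ 2)⁻¹ * ∫⁻ x, h x := by
  have := Measure.map_addHaar_smul (volume : Measure Plane) hr
  rw [Module.finrank_fin_fun, abs_of_nonneg (by positivity)] at this
  rw [← lintegral_map hh (measurable_const_smul r), this, lintegral_smul_measure, smul_eq_mul]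

/-- The intensity of the random point set `K M`. -/
def intensity (P : Measure ASL) (K : Set Plane) : Measure Plane :=
  Measure.sum fun v : K => P.map fun g => (v : Plane) ᵥ* (g.lin : Mat)

instance (P : Measure ASL) [SFinite P] (K : Set Plane) [Countable K] : SFinite (intensity P K) := by
  unfold intensity
  infer_instance

theorem lintegral_intensity (P : Measure ASL) (K : Set Plane) [Countable K] (F : Plane → ℝ≥0∞)
    (hF : Measurable F) :
    ∫⁻ x, F x ∂intensity P K = ∫⁻ g, ∑' v : K, F ((v : Plane) ᵥ* (g.lin : Mat)) ∂P := by
  rw [intensity, lintegral_sum_measure,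
    lintegral_tsum (f := fun (v : K) (g : ASL) => F ((v : Plane) ᵥ* (g.lin : Mat)))
      fun v => (hF.comp (measurable_vecMul_lin _)).aemeasurable]
  exact tsum_congr fun v => lintegral_map hF (measurable_vecMul_lin _)

theorem vecMul_mul_coe (v : Plane) (A B : SpecialLinearGroup (Fin 2) ℝ) :
    v ᵥ* ((A * B : SpecialLinearGroup (Fin 2) ℝ) : Mat) = (v ᵥ* (A : Mat)) ᵥ* (B : Mat) :=
  (Matrix.vecMul_vecMul _ _ _).symm

theorem vecMul_inv_cancel (v : Plane) (A : SpecialLinearGroup (Fin 2) ℝ) :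
    (v ᵥ* (A : Mat)) ᵥ* ((A⁻¹ : SpecialLinearGroup (Fin 2) ℝ) : Mat) = v := by
  rw [← vecMul_mul_coe, mul_inv_cancel]
  exact Matrix.vecMul_one v

theorem vecMul_inv_cancel' (v : Plane) (A : SpecialLinearGroup (Fin 2) ℝ) :
    (v ᵥ* ((A⁻¹ : SpecialLinearGroup (Fin 2) ℝ) : Mat)) ᵥ* (A : Mat) = v := by
  rw [← vecMul_mul_coe, inv_mul_cancel]
  exact Matrix.vecMul_one v

/-- `K` is stable under the congruence subgroup. -/
def IsStable (K : Set Plane) : Prop :=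
  ∀ γ ∈ congrSubgroup, ∀ v ∈ K, v ᵥ* (toReal γ : Mat) ∈ K

/-- The permutation of a stable set given by an element of the congruence subgroup. -/
def IsStable.equiv {K : Set Plane} (hK : IsStable K) {γ : SpecialLinearGroup (Fin 2) ℤ}
    (hγ : γ ∈ congrSubgroup) : K ≃ K where
  toFun v := ⟨_, hK γ hγ v v.2⟩
  invFun v := ⟨_, hK γ⁻¹ (inv_mem hγ) v v.2⟩
  left_inv v := Subtype.ext (by
    simp only [map_inv]
    exact vecMul_inv_cancel _ _)
  right_inv v := Subtype.ext (by
    simp only [map_inv]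
    exact vecMul_inv_cancel' _ _)

theorem IsStable.tsum_mul {K : Set Plane} (hK : IsStable K) {γ : SpecialLinearGroup (Fin 2) ℤ}
    (hγ : γ ∈ congrSubgroup) (M : SpecialLinearGroup (Fin 2) ℝ) (F : Plane → ℝ≥0∞) :
    ∑' v : K, F ((v : Plane) ᵥ* ((toReal γ * M : SpecialLinearGroup (Fin 2) ℝ) : Mat))
      = ∑' v : K, F ((v : Plane) ᵥ* (M : Mat)) := by
  rw [← (hK.equiv hγ).tsum_eq fun v : K => F ((v : Plane) ᵥ* (M : Mat))]
  exact tsum_congr fun v => congrArg F (vecMul_mul_coe _ _ _)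

/-- Stability makes sums over `K M` left `Λ`-invariant, so translating by `(M, 0)` shows that the
intensity is `SL(2, ℝ)`-invariant. Invertible matrices never send a nonzero vector to the origin.
The constant may still be `∞` here. -/
theorem IsLift.exists_intensity_eq {P : Measure ASL} (hP : IsLift P) {K : Set Plane} [Countable K]
    (hK : IsStable K) (h0 : (0 : Plane) ∉ K) : ∃ c : ℝ≥0∞, intensity P K = c • volume := by
  have := hP.prob
  refine exists_eq_smul_volume _ ?_ fun M => ?_
  · rw [intensity, Measure.sum_apply _ (measurableSet_singleton 0), ENNReal.tsum_eq_zero]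
    intro v
    rw [Measure.map_apply (measurable_vecMul_lin _) (measurableSet_singleton 0)]
    convert measure_empty (μ := P)
    ext g
    simp only [Set.mem_preimage, Set.mem_singleton_iff, Set.mem_empty_iff_false, iff_false]
    intro h
    have h2 := vecMul_inv_cancel (v : Plane) g.lin
    rw [h, Matrix.zero_vecMul] at h2
    exact h0 (h2 ▸ v.2)
  · refine Measure.ext_of_lintegral _ fun F hF => ?_
    rw [lintegral_map hF (measurable_vecMul _),
      lintegral_intensity P K (fun v => F (v ᵥ* (M : Mat))) (hF.comp (measurable_vecMul _)),
      lintegral_intensity P K F hF,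
      ← hP.lintegral_mul_right (fun g => ∑' v : K, F ((v : Plane) ᵥ* (g.lin : Mat)))
        (Measurable.tsum fun v => hF.comp (measurable_vecMul_lin _)) ?_ ⟨M, 0⟩]
    · refine lintegral_congr fun g => tsum_congr fun v => congrArg F ?_
      exact (vecMul_mul_coe _ _ _).symm
    · rintro γ ⟨⟨A, hA, hγA⟩, -⟩ g
      rw [ASL.mul_lin, hγA]
      exact hK.tsum_mul hA g.lin F

/-! ### Finite intensity of the primitive vectors -/

/-- The primitive vectors of `ℤ²`. -/
def primitiveVectors : Set Plane := toPlane '' {m | IsCoprime (m 0) (m 1)}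

instance : Countable primitiveVectors :=
  ((Set.to_countable {m : Lattice | IsCoprime (m 0) (m 1)}).image toPlane).to_subtype

theorem isStable_primitiveVectors : IsStable primitiveVectors := by
  rintro γ - _ ⟨m, hm, rfl⟩
  rw [toPlane_vecMul]
  exact ⟨_, IsCoprime.vecMulSL hm γ, rfl⟩

theorem zero_notMem_primitiveVectors : (0 : Plane) ∉ primitiveVectors := by
  rintro ⟨m, hm, h⟩
  have : m = 0 := toPlane_injective (h.trans (by ext; simp [toPlane]))
  rw [this] at hm
  exact not_isCoprime_zero_zero hm

/-- The square of side one centred at the origin. -/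
def centredSquare : Set Plane := Set.univ.pi fun _ => Set.Ioo (-(1 / 2) : ℝ) (1 / 2)

theorem measurableSet_centredSquare : MeasurableSet centredSquare :=
  MeasurableSet.univ_pi fun _ => measurableSet_Ioo

theorem volume_centredSquare : volume centredSquare = 1 := by
  simp [centredSquare, volume_pi_pi]
  norm_num

theorem abs_lt_of_mem_centredSquare {x : Plane} (hx : x ∈ centredSquare) (i : Fin 2) :
    |x i| < 1 / 2 :=
  abs_lt.2 (hx i (Set.mem_univ i))

theorem eq_or_eq_neg_of_isCoprime {a b c d : ℤ} (h : IsCoprime a b) (h' : IsCoprime c d)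
    (hd : a * d = b * c) : (c = a ∧ d = b) ∨ (c = -a ∧ d = -b) := by
  obtain ⟨x, y, hxy⟩ := h
  -- Proportional vectors: the factor taking `(a, b)` to `(c, d)` is read off from a Bézout relation
  -- for `(a, b)`, and coprimality of `(c, d)` makes it a unit.
  have hc : c = (x * c + y * d) * a := by linear_combination (-c) * hxy - y * hd
  have hd' : d = (x * c + y * d) * b := by linear_combination (-d) * hxy + x * hd
  have hu : IsUnit (x * c + y * d) := h'.isUnit_of_dvd' ⟨a, hc⟩ ⟨b, hd'⟩
  rcases Int.isUnit_iff.1 hu with h1 | h1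
  · left
    rw [h1] at hc hd'
    omega
  · right
    rw [h1] at hc hd'
    omega

theorem det_vecMul (M : SpecialLinearGroup (Fin 2) ℝ) (v w : Plane) :
    (v ᵥ* (M : Mat)) 0 * (w ᵥ* (M : Mat)) 1 - (v ᵥ* (M : Mat)) 1 * (w ᵥ* (M : Mat)) 0
      = v 0 * w 1 - v 1 * w 0 := by
  have hd : (M : Mat) 0 0 * (M : Mat) 1 1 - (M : Mat) 0 1 * (M : Mat) 1 0 = 1 := by
    rw [← det_fin_two]
    exact M.2
  simp only [Matrix.vecMul, dotProduct, Fin.sum_univ_two]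
  linear_combination (v 0 * w 1 - v 1 * w 0) * hd

/-- The determinant of the two vectors is an integer preserved by `M`, and coordinates below `1/2`
force it below one in absolute value. It vanishes, so the primitive vectors agree up to sign. -/
theorem eq_or_eq_neg_of_mem_centredSquare (M : SpecialLinearGroup (Fin 2) ℝ) {v w : Plane}
    (hv : v ∈ primitiveVectors) (hw : w ∈ primitiveVectors) (hvM : v ᵥ* (M : Mat) ∈ centredSquare)
    (hwM : w ᵥ* (M : Mat) ∈ centredSquare) : w = v ∨ w = -v := by
  obtain ⟨m, hm, rfl⟩ := hv
  obtain ⟨n, hn, rfl⟩ := hw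
  have hdet := det_vecMul M (toPlane m) (toPlane n)
  have a0 := abs_lt_of_mem_centredSquare hvM 0
  have a1 := abs_lt_of_mem_centredSquare hvM 1
  have b0 := abs_lt_of_mem_centredSquare hwM 0
  have b1 := abs_lt_of_mem_centredSquare hwM 1
  have hlt : |toPlane m 0 * toPlane n 1 - toPlane m 1 * toPlane n 0| < 1 := by
    rw [← hdet]
    refine (abs_sub _ _).trans_lt ?_
    rw [abs_mul, abs_mul]
    have h1 := mul_le_mul a0.le b1.le (abs_nonneg _) (by norm_num)
    have h2 := mul_le_mul a1.le b0.le (abs_nonneg _) (by norm_num)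
    linarith
  have hz : |m 0 * n 1 - m 1 * n 0| < 1 := by
    simp only [toPlane] at hlt
    exact_mod_cast hlt
  rw [Int.abs_lt_one_iff, sub_eq_zero] at hz
  rcases eq_or_eq_neg_of_isCoprime hm hn hz with ⟨h0, h1⟩ | ⟨h0, h1⟩
  · left
    congr 1
    ext i
    fin_cases i <;> assumption
  · right
    rw [← toPlane_neg]
    congr 1
    ext i
    fin_cases i <;> assumption

theorem tsum_primitiveVectors_le (M : SpecialLinearGroup (Fin 2) ℝ) :
    ∑' v : primitiveVectors, centredSquare.indicator (1 : Plane → ℝ≥0∞) ((v : Plane) ᵥ* (M : Mat))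
      ≤ 2 := by
  classical
  by_cases h : ∃ v ∈ primitiveVectors, v ᵥ* (M : Mat) ∈ centredSquare
  · obtain ⟨v, hv, hvM⟩ := h
    rw [tsum_subtype primitiveVectors
      fun v => centredSquare.indicator (1 : Plane → ℝ≥0∞) (v ᵥ* (M : Mat)),
      tsum_eq_sum (s := {v, -v})]
    · calc _ ≤ ∑ w ∈ ({v, -v} : Finset Plane), (1 : ℝ≥0∞) :=
            Finset.sum_le_sum fun w _ => by
              refine Set.indicator_le' (fun _ _ => ?_) (fun _ _ => zero_le_one) w
              exact Set.indicator_le_self' (fun _ _ => zero_le_one) _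
        _ ≤ 2 := by
            rw [Finset.sum_const, nsmul_eq_mul, mul_one]
            exact_mod_cast Finset.card_le_two
    · intro w hw
      by_contra hne
      have hwK : w ∈ primitiveVectors := Set.mem_of_indicator_ne_zero hne
      rw [Set.indicator_of_mem hwK] at hne
      have hwM := Set.mem_of_indicator_ne_zero hne
      rcases eq_or_eq_neg_of_mem_centredSquare M hv hwK hvM hwM with rfl | rfl <;> simp at hw
  · push Not at h
    rw [ENNReal.tsum_eq_zero.2]
    · exact zero_le
    · exact fun v => Set.indicator_of_notMem (h v v.2) _

theorem IsLift.exists_intensity_primitiveVectors {P : Measure ASL} (hP : IsLift P) :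
    ∃ c : ℝ≥0∞, c ≠ ∞ ∧ intensity P primitiveVectors = c • volume := by
  have := hP.prob
  obtain ⟨c, hc⟩ := hP.exists_intensity_eq isStable_primitiveVectors zero_notMem_primitiveVectors
  refine ⟨c, ?_, hc⟩
  have h1 : c = intensity P primitiveVectors centredSquare := by
    rw [hc, Measure.smul_apply, volume_centredSquare, smul_eq_mul, mul_one]
  have h2 : intensity P primitiveVectors centredSquare ≤ 2 := by
    rw [← lintegral_indicator_one measurableSet_centredSquare, lintegral_intensity _ _ _
      (measurable_one.indicator measurableSet_centredSquare)]
    calc _ ≤ ∫⁻ _, 2 ∂P := lintegral_mono fun g => tsum_primitiveVectors_le g.lin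
      _ = 2 := by simp
  rw [h1]
  exact (h2.trans_lt (by simp)).ne

/-! ### Translated lattices and finiteness for all nonzero lattice vectors -/

/-- The nonzero points of the translate `ℤ² + η`. -/
def shiftedLattice (η : Plane) : Set Plane := {v | v ≠ 0 ∧ ∃ m, toPlane m + η = v}

instance (η : Plane) : Countable (shiftedLattice η) :=
  ((Set.countable_range fun m => toPlane m + η).mono fun _ hv => hv.2).to_subtype

theorem isStable_shiftedLattice {η : Plane}
    (hη : ∀ γ ∈ congrSubgroup, ∃ n, η ᵥ* (toReal γ : Mat) = toPlane n + η) :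
    IsStable (shiftedLattice η) := by
  rintro γ hγ _ ⟨hne, m, rfl⟩
  refine ⟨fun h => hne ?_, ?_⟩
  · rw [← vecMul_inv_cancel (toPlane m + η) (toReal γ), h, Matrix.zero_vecMul]
  · obtain ⟨n, hn⟩ := hη γ hγ
    refine ⟨m ᵥ* γ.1 + n, ?_⟩
    rw [Matrix.add_vecMul, toPlane_vecMul, hn, toPlane_add, add_assoc]

theorem isStable_shiftedLattice_zero : IsStable (shiftedLattice 0) :=
  isStable_shiftedLattice fun γ _ => ⟨0, by
    rw [Matrix.zero_vecMul]
    ext i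
    simp [toPlane]⟩

theorem zero_notMem_shiftedLattice (η : Plane) : (0 : Plane) ∉ shiftedLattice η := fun h => h.1 rfl

theorem exists_eq_smul_primitive (v : shiftedLattice 0) :
    ∃ q : ℕ × primitiveVectors, (v : Plane) = ((q.1 : ℝ) + 1) • (q.2 : Plane) := by
  obtain ⟨v, hv, m, rfl⟩ := v
  have hm : m ≠ 0 := by
    rintro rfl
    apply hv
    ext i
    simp [toPlane]
  have hg : 0 < Int.gcd (m 0) (m 1) := by
    rw [Nat.pos_iff_ne_zero, Ne, Int.gcd_eq_zero_iff]
    rintro ⟨h0, h1⟩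
    apply hm
    ext i
    fin_cases i <;> assumption
  obtain ⟨a, b, hab, h0, h1⟩ := Int.exists_gcd_one hg
  -- The index is the gcd minus one, since `k : ℕ` encodes the multiplier `k + 1`.
  refine ⟨⟨Int.gcd (m 0) (m 1) - 1, toPlane ![a, b], ![a, b], Int.isCoprime_iff_gcd_eq_one.2 hab,
    rfl⟩, ?_⟩
  have hc : ((Int.gcd (m 0) (m 1) - 1 : ℕ) : ℝ) + 1 = (Int.gcd (m 0) (m 1) : ℝ) := by
    rw [Nat.cast_pred hg]
    ring
  simp only [hc]
  have h0' : (m 0 : ℝ) = a * (Int.gcd (m 0) (m 1) : ℝ) := by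
    exact_mod_cast h0
  have h1' : (m 1 : ℝ) = b * (Int.gcd (m 0) (m 1) : ℝ) := by
    exact_mod_cast h1
  ext i
  fin_cases i
  · simp [toPlane]
    linarith
  · simp [toPlane]
    linarith

/-- Every nonzero integer vector is a positive multiple of a primitive one, and the `k`-fold
multiples have intensity `k⁻²` times that of the primitive vectors. -/
theorem IsLift.exists_intensity_shiftedLattice_zero {P : Measure ASL} (hP : IsLift P) :
    ∃ c : ℝ≥0∞, c ≠ ∞ ∧ intensity P (shiftedLattice 0) = c • volume := by
  have := hP.prob
  obtain ⟨c, hc⟩ := hP.exists_intensity_eq isStable_shiftedLattice_zero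
    (zero_notMem_shiftedLattice 0)
  obtain ⟨d, hd, hdp⟩ := hP.exists_intensity_primitiveVectors
  refine ⟨c, ?_, hc⟩
  choose q hq using exists_eq_smul_primitive
  have hinj : Function.Injective q := fun v w h => Subtype.ext (by rw [hq v, hq w, h])
  let F : Plane → ℝ≥0∞ := centredSquare.indicator 1
  have hF : Measurable F := measurable_one.indicator measurableSet_centredSquare
  have hF1 : ∫⁻ x, F x = 1 := by
    rw [lintegral_indicator_one measurableSet_centredSquare, volume_centredSquare]
  have h1 : c = ∫⁻ x, F x ∂intensity P (shiftedLattice 0) := by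
    rw [hc, lintegral_smul_measure, hF1, smul_eq_mul, mul_one]
  have hFd : ∀ k : ℕ, Measurable fun x => F (((k : ℝ) + 1) • x) := fun k =>
    hF.comp (measurable_const_smul _)
  have h2 : ∫⁻ x, F x ∂intensity P (shiftedLattice 0)
      ≤ ∑' k : ℕ, ∫⁻ x, F (((k : ℝ) + 1) • x) ∂intensity P primitiveVectors := by
    simp_rw [fun k => lintegral_intensity P primitiveVectors _ (hFd k)]
    rw [lintegral_intensity _ _ _ hF, ← lintegral_tsum
      (f := fun (k : ℕ) (g : ASL) => ∑' v : primitiveVectors,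
        F (((k : ℝ) + 1) • ((v : Plane) ᵥ* (g.lin : Mat)))) fun k =>
      (Measurable.tsum fun v => (hFd k).comp (measurable_vecMul_lin _)).aemeasurable]
    refine lintegral_mono fun g => ?_
    let G : ℕ × primitiveVectors → ℝ≥0∞ := fun q =>
      F (((q.1 : ℝ) + 1) • ((q.2 : Plane) ᵥ* (g.lin : Mat)))
    have e1 : ∀ v : shiftedLattice 0, F ((v : Plane) ᵥ* (g.lin : Mat)) = G (q v) := by
      intro v
      simp only [G]
      rw [← Matrix.smul_vecMul, ← hq]
    calc ∑' v : shiftedLattice 0, F ((v : Plane) ᵥ* (g.lin : Mat)) = ∑' v, G (q v) :=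
          tsum_congr e1
      _ ≤ ∑' q, G q := ENNReal.tsum_comp_le_tsum_of_injective hinj G
      _ = _ := ENNReal.tsum_prod'
  rw [h1]
  refine ne_top_of_le_ne_top ?_ h2
  rw [hdp]
  have h3 : ∀ k : ℕ, ∫⁻ x, F (((k : ℝ) + 1) • x) ∂(d • (volume : Measure Plane))
      = d * ENNReal.ofReal (((k : ℝ) + 1) ^ 2)⁻¹ := by
    intro k
    rw [lintegral_smul_measure, lintegral_comp_smul (by positivity) _ hF, hF1, mul_one, smul_eq_mul]
  rw [tsum_congr h3, ENNReal.tsum_mul_left]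
  refine ENNReal.mul_ne_top hd (Summable.tsum_ofReal_ne_top ?_)
  have := (summable_nat_add_iff 1).2 (Real.summable_nat_pow_inv.2 (one_lt_two))
  simpa using this

theorem tsum_shiftedLattice (η : Plane) (F : Plane → ℝ≥0∞) (h0 : F 0 = 0) :
    ∑' v : shiftedLattice η, F v = ∑' m, F (toPlane m + η) := by
  choose i hi using fun v : shiftedLattice η => v.2.2
  have hinj : Function.Injective i := fun v w h => Subtype.ext (by rw [← hi v, ← hi w, h])
  rw [← hinj.tsum_eq (f := fun m => F (toPlane m + η))]
  · exact tsum_congr fun v => by rw [hi]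
  · intro m hm
    have hne : toPlane m + η ≠ 0 := fun h => hm (by simp only [h, h0])
    refine ⟨⟨_, hne, m, rfl⟩, toPlane_injective ?_⟩
    exact add_right_cancel (hi ⟨_, hne, m, rfl⟩)

/-! ### Lattice point counts in squares -/

theorem indicator_one_le_indicator_one {s t : Set Plane} {x y : Plane} (h : x ∈ s → y ∈ t) :
    s.indicator (1 : Plane → ℝ≥0∞) x ≤ t.indicator 1 y := by
  by_cases hx : x ∈ s
  · rw [Set.indicator_of_mem hx, Set.indicator_of_mem (h hx)]
    exact le_rfl
  · rw [Set.indicator_of_notMem hx]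
    exact zero_le

/-- The number of nonzero points of `ℤ² M` in the open square of side two centred at the origin. -/
def shortCount (M : SpecialLinearGroup (Fin 2) ℝ) : ℝ≥0∞ :=
  ∑' v : shiftedLattice 0,
    (Metric.ball (0 : Plane) 1).indicator (1 : Plane → ℝ≥0∞) ((v : Plane) ᵥ* (M : Mat))

theorem tsum_ball_le (M : SpecialLinearGroup (Fin 2) ℝ) :
    ∑' m, (Metric.ball (0 : Plane) 1).indicator (1 : Plane → ℝ≥0∞) (toPlane m ᵥ* (M : Mat))
      ≤ 1 + shortCount M := by
  classical
  rw [ENNReal.tsum_eq_add_tsum_ite 0]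
  refine add_le_add (Set.indicator_le_self' (fun _ _ => zero_le_one) _) ?_
  let F : Plane → ℝ≥0∞ := fun v =>
    if v = 0 then 0 else (Metric.ball (0 : Plane) 1).indicator 1 (v ᵥ* (M : Mat))
  have h := tsum_shiftedLattice 0 F (if_pos rfl)
  have hz : ∀ m : Lattice, toPlane m = 0 ↔ m = 0 := fun m =>
    ⟨fun h => toPlane_injective (h.trans (by ext; simp [toPlane])), fun h => by
      ext
      simp [h, toPlane]⟩
  refine le_trans (tsum_congr fun m => ?_).le (h.symm.le.trans ?_)
  · by_cases hm : m = 0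
    · rw [if_pos hm]
      simp only [F, add_zero, hz, if_pos hm]
    · rw [if_neg hm]
      simp only [F, add_zero, hz, if_neg hm]
  refine ENNReal.tsum_le_tsum fun v => ?_
  simp only [F]
  split_ifs
  · exact zero_le
  · exact le_rfl

/-- Subtracting one fixed point of the translated lattice in the square sends all others to vectors
of `ℤ² M` of sup norm below one, which bounds the count independently of `η` and `j`. -/
theorem tsum_square_le (M : SpecialLinearGroup (Fin 2) ℝ) (η : Plane) (j : Lattice) :
    ∑' m, (square j).indicator (1 : Plane → ℝ≥0∞) ((toPlane m + η) ᵥ* (M : Mat))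
      ≤ 1 + shortCount M := by
  by_cases h : ∃ m₀, (toPlane m₀ + η) ᵥ* (M : Mat) ∈ square j
  · obtain ⟨m₀, hm₀⟩ := h
    refine le_trans ?_ (tsum_ball_le M)
    rw [← (Equiv.subRight m₀).tsum_eq fun m =>
      (Metric.ball (0 : Plane) 1).indicator (1 : Plane → ℝ≥0∞) (toPlane m ᵥ* (M : Mat))]
    refine ENNReal.tsum_le_tsum fun m => ?_
    refine indicator_one_le_indicator_one fun hm => ?_
    have e : toPlane (Equiv.subRight m₀ m) ᵥ* (M : Mat)
        = (toPlane m + η) ᵥ* (M : Mat) - (toPlane m₀ + η) ᵥ* (M : Mat) := by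
      rw [← Matrix.sub_vecMul, Equiv.subRight_apply]
      congr 1
      ext i
      simp [toPlane]
    rw [e, mem_ball_zero_iff, pi_norm_lt_iff zero_lt_one]
    intro i
    have h1 := hm i (Set.mem_univ i)
    have h2 := hm₀ i (Set.mem_univ i)
    rw [Pi.sub_apply, Real.norm_eq_abs, abs_lt]
    constructor <;> linarith [h1.1, h1.2, h2.1, h2.2]
  · push Not at h
    rw [ENNReal.tsum_eq_zero.2 fun m => Set.indicator_of_notMem (h m) _]
    exact zero_le

/-! ### Dilated bump sums: domination and convergence -/

/-- The lower left corner of the unit square containing a point. -/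
def corner (x : Plane) : Lattice := fun i => ⌊x i⌋

/-- A continuous function on the plane with support in the unit ball that vanishes at the origin. -/
def bump (x : Plane) : ℝ≥0∞ := ENNReal.ofReal (‖x‖ * (1 - ‖x‖))

theorem continuous_bump : Continuous bump := by
  exact ENNReal.continuous_ofReal.comp (by fun_prop)

theorem bump_zero : bump 0 = 0 := by simp [bump]

theorem bump_le (x : Plane) : bump x ≤ (Metric.ball (0 : Plane) 1).indicator 1 x := by
  by_cases hx : ‖x‖ < 1
  · rw [Set.indicator_of_mem (by simpa using hx), Pi.one_apply, bump, ENNReal.ofReal_le_one]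
    nlinarith [norm_nonneg x]
  · rw [bump, ENNReal.ofReal_of_nonpos]
    · exact zero_le
    · nlinarith [norm_nonneg x]

theorem lintegral_bump_ne_zero : ∫⁻ x, bump x ≠ 0 := by
  rw [Ne, lintegral_eq_zero_iff continuous_bump.measurable]
  intro h
  have h2 := (continuous_bump.ae_eq_iff_eq volume continuous_zero).1 h
  have h3 := congrFun h2 (fun _ => 1 / 2)
  have h4 : ‖(fun _ => 1 / 2 : Plane)‖ = 1 / 2 := by
    rw [pi_norm_const]
    norm_num
  rw [bump, h4] at h3
  norm_num at h3

theorem lintegral_bump_ne_top : ∫⁻ x, bump x ≠ ∞ := by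
  refine ne_top_of_le_ne_top ?_ (lintegral_mono bump_le)
  rw [lintegral_indicator_one measurableSet_ball]
  exact measure_ball_lt_top.ne

/-- The dilated bump lives on a square of side `2(n + 1)`, covered by `4(n + 1)²` unit squares; the
normalization cancels their number, leaving a bound independent of `n`. -/
theorem tsum_bump_le (M : SpecialLinearGroup (Fin 2) ℝ) (η : Plane) (n : ℕ) :
    ENNReal.ofReal (((n : ℝ) + 1) ^ 2)⁻¹ *
      ∑' m, bump (((n : ℝ) + 1)⁻¹ • ((toPlane m + η) ᵥ* (M : Mat))) ≤ 4 * (1 + shortCount M) := by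
  let J : Finset Lattice := Fintype.piFinset fun _ => Finset.Ico (-((n : ℤ) + 1)) (n + 1)
  have hJ : (J.card : ℝ≥0∞) = 4 * ENNReal.ofReal (((n : ℝ) + 1) ^ 2) := by
    have : J.card = 4 * (n + 1) ^ 2 := by
      rw [Fintype.card_piFinset_const, Int.card_Ico]
      have : ((n : ℤ) + 1 - -((n : ℤ) + 1)).toNat = 2 * (n + 1) := by omega
      rw [this]
      ring
    rw [this]
    push_cast
    rw [ENNReal.ofReal_pow (by positivity), ENNReal.ofReal_add (by positivity) zero_le_one]
    simp
  have h1 : ∀ x : Plane, bump (((n : ℝ) + 1)⁻¹ • x)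
      ≤ ∑ j ∈ J, (square j).indicator (1 : Plane → ℝ≥0∞) x := by
    intro x
    by_cases hx : ‖((n : ℝ) + 1)⁻¹ • x‖ < 1
    · have hn : (0 : ℝ) < n + 1 := by positivity
      rw [norm_smul, Real.norm_of_nonneg (by positivity), inv_mul_lt_one₀ hn,
        pi_norm_lt_iff hn] at hx
      have hc : corner x ∈ J := by
        refine Fintype.mem_piFinset.2 fun i => Finset.mem_Ico.2 ?_
        have hi := abs_lt.1 (hx i)
        constructor
        · rw [corner, Int.le_floor]
          push_cast
          exact hi.1.le
        · rw [corner, Int.floor_lt]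
          push_cast
          exact hi.2
      refine le_trans ?_ (Finset.single_le_sum (fun _ _ => zero_le) hc)
      exact (bump_le _).trans (indicator_one_le_indicator_one fun _ => mem_square.2 fun _ => rfl)
    · refine (bump_le _).trans ?_
      rw [Set.indicator_of_notMem (by simpa using hx)]
      exact zero_le
  calc _ ≤ ENNReal.ofReal (((n : ℝ) + 1) ^ 2)⁻¹ * ∑' m, ∑ j ∈ J,
          (square j).indicator (1 : Plane → ℝ≥0∞) ((toPlane m + η) ᵥ* (M : Mat)) := by
        gcongr
        exact h1 _
    _ = ENNReal.ofReal (((n : ℝ) + 1) ^ 2)⁻¹ * ∑ j ∈ J, ∑' m,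
          (square j).indicator (1 : Plane → ℝ≥0∞) ((toPlane m + η) ᵥ* (M : Mat)) := by
        rw [Summable.tsum_finsetSum fun _ _ => ENNReal.summable]
    _ ≤ ENNReal.ofReal (((n : ℝ) + 1) ^ 2)⁻¹ * ∑ j ∈ J, (1 + shortCount M) := by
        gcongr
        exact tsum_square_le M η _
    _ = 4 * (1 + shortCount M) := by
        rw [Finset.sum_const, nsmul_eq_mul, hJ, ← mul_assoc, mul_left_comm,
          ← ENNReal.ofReal_mul (by positivity), inv_mul_cancel₀ (by positivity)]
        simp

theorem measurable_corner : Measurable corner :=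
  measurable_pi_lambda _ fun i => Int.measurable_floor.comp (measurable_pi_apply i)

theorem lintegral_corner (a : Lattice → ℝ≥0∞) : ∫⁻ x, a (corner x) = ∑' m, a m := by
  rw [lintegral_eq_tsum_square]
  refine tsum_congr fun m => ?_
  have h : ∀ x ∈ square m, a (corner x) = a m := fun x hx =>
    congrArg a (funext (mem_square.1 hx))
  rw [setLIntegral_congr_fun (measurableSet_square m) h, lintegral_const,
    Measure.restrict_apply_univ, volume_square, mul_one]

theorem norm_corner_sub_le (x : Plane) : ‖toPlane (corner x) - x‖ ≤ 1 := by
  refine (pi_norm_le_iff_of_nonneg zero_le_one).2 fun i => ?_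
  simp only [toPlane, corner, Pi.sub_apply, Real.norm_eq_abs]
  rw [abs_le]
  constructor <;> linarith [Int.floor_le (x i), Int.lt_floor_add_one (x i)]

theorem norm_rescaled_corner_sub_le (η x : Plane) (n : ℕ) :
    ‖((n : ℝ) + 1)⁻¹ • (toPlane (corner (((n : ℝ) + 1) • x)) + η) - x‖
      ≤ ((n : ℝ) + 1)⁻¹ * (1 + ‖η‖) := by
  have hn : (n : ℝ) + 1 ≠ 0 := by positivity
  have : ((n : ℝ) + 1)⁻¹ • (toPlane (corner (((n : ℝ) + 1) • x)) + η) - x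
      = ((n : ℝ) + 1)⁻¹ • ((toPlane (corner (((n : ℝ) + 1) • x)) - ((n : ℝ) + 1) • x) + η) := by
    rw [smul_add, smul_add, smul_sub, smul_smul, inv_mul_cancel₀ hn, one_smul]
    abel
  rw [this, norm_smul, Real.norm_of_nonneg (by positivity)]
  gcongr
  exact (norm_add_le _ _).trans (by gcongr; exact norm_corner_sub_le _)

theorem tendsto_rescaled_corner (η x : Plane) :
    Filter.Tendsto (fun n : ℕ => ((n : ℝ) + 1)⁻¹ • (toPlane (corner (((n : ℝ) + 1) • x)) + η))
      Filter.atTop (nhds x) := by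
  rw [tendsto_iff_norm_sub_tendsto_zero]
  refine squeeze_zero (fun _ => norm_nonneg _) (fun n => norm_rescaled_corner_sub_le η x n) ?_
  have := (tendsto_one_div_add_atTop_nhds_zero_nat (𝕜 := ℝ)).mul_const (1 + ‖η‖)
  simpa using this

/-- The normalized sum is a Riemann sum: it is the integral of a step function built from rescaled
corners, converging pointwise to `bump (x ᵥ* M)`, whose integral is that of `bump` as `M` preserves
area. -/
theorem tendsto_tsum_bump (M : SpecialLinearGroup (Fin 2) ℝ) (η : Plane) :
    Filter.Tendsto (fun n : ℕ => ENNReal.ofReal (((n : ℝ) + 1) ^ 2)⁻¹ *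
      ∑' m, bump (((n : ℝ) + 1)⁻¹ • ((toPlane m + η) ᵥ* (M : Mat)))) Filter.atTop
      (nhds (∫⁻ x, bump x)) := by
  have hmb : Measurable bump := continuous_bump.measurable
  have hmt : Measurable toPlane := measurable_of_countable _
  let G : ℕ → Plane → ℝ≥0∞ := fun n x =>
    bump ((((n : ℝ) + 1)⁻¹ • (toPlane (corner (((n : ℝ) + 1) • x)) + η)) ᵥ* (M : Mat))
  have hmc : ∀ n : ℕ, Measurable fun x : Plane => toPlane (corner (((n : ℝ) + 1) • x)) + η :=
    fun n => ((hmt.comp measurable_corner).comp (measurable_const_smul _)).add_const η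
  have hG : ∀ n, Measurable (G n) := fun n =>
    hmb.comp ((measurable_vecMul _).comp ((measurable_const_smul _).comp (hmc n)))
  have hsum : ∀ n : ℕ, ENNReal.ofReal (((n : ℝ) + 1) ^ 2)⁻¹ *
      ∑' m, bump (((n : ℝ) + 1)⁻¹ • ((toPlane m + η) ᵥ* (M : Mat))) = ∫⁻ x, G n x := by
    intro n
    rw [← lintegral_corner fun m => bump (((n : ℝ) + 1)⁻¹ • ((toPlane m + η) ᵥ* (M : Mat))),
      ← lintegral_comp_smul (by positivity)]
    · simp only [G, Matrix.smul_vecMul]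
    · exact hmb.comp ((measurable_const_smul _).comp ((measurable_vecMul _).comp
        ((hmt.comp measurable_corner).add_const η)))
  simp_rw [hsum]
  rw [← lintegral_vecMul M bump hmb]
  -- Boundedness of `M⁻¹` on the unit ball confines all the step functions to one fixed ball.
  obtain ⟨C, hC⟩ : ∃ C, ∀ w : Plane, ‖w ᵥ* (M : Mat)‖ ≤ 1 → ‖w‖ ≤ C := by
    have hcont : Continuous fun v : Plane =>
        v ᵥ* ((M⁻¹ : SpecialLinearGroup (Fin 2) ℝ) : Mat) :=
      continuous_id.matrix_vecMul continuous_const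
    obtain ⟨C, hC⟩ := ((isCompact_closedBall (0 : Plane) 1).image hcont).isBounded.exists_norm_le
    refine ⟨C, fun w hw => hC w ⟨w ᵥ* (M : Mat), by simpa using hw, vecMul_inv_cancel w M⟩⟩
  refine tendsto_lintegral_of_dominated_convergence
    ((Metric.closedBall (0 : Plane) (C + (1 + ‖η‖))).indicator 1) hG (fun n => ?_) ?_ ?_
  · refine Filter.Eventually.of_forall fun x => ?_
    refine (bump_le _).trans ?_
    refine indicator_one_le_indicator_one fun hw => ?_
    have h1 := hC _ (mem_ball_zero_iff.1 hw).le
    have h2 := norm_rescaled_corner_sub_le η x n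
    have h3 : ((n : ℝ) + 1)⁻¹ * (1 + ‖η‖) ≤ 1 + ‖η‖ :=
      mul_le_of_le_one_left (by positivity) (inv_le_one_of_one_le₀ (by simp))
    rw [mem_closedBall_zero_iff]
    have h4 := norm_le_insert ((((n : ℝ) + 1)⁻¹ • (toPlane (corner (((n : ℝ) + 1) • x)) + η))) x
    linarith
  · rw [lintegral_indicator_one measurableSet_closedBall]
    exact measure_closedBall_lt_top.ne
  · refine Filter.Eventually.of_forall fun x => ?_
    have hc : Continuous fun v : Plane => bump (v ᵥ* (M : Mat)) :=
      continuous_bump.comp (continuous_id.matrix_vecMul continuous_const)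
    exact (hc.tendsto x).comp (tendsto_rescaled_corner η x)

/-! ### Siegel's mean value formula -/

/-- The normalizing factor cancels the Jacobian of the dilation, so the mean does not depend on `n`.
As `bump` vanishes at the origin, omitting the zero vector changes nothing. -/
theorem lintegral_rescaled_bump {P : Measure ASL} [SFinite P] {η : Plane} {c : ℝ≥0∞}
    (hc : intensity P (shiftedLattice η) = c • volume) (n : ℕ) :
    ∫⁻ g, ENNReal.ofReal (((n : ℝ) + 1) ^ 2)⁻¹ *
      ∑' m, bump (((n : ℝ) + 1)⁻¹ • ((toPlane m + η) ᵥ* (g.lin : Mat))) ∂P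
      = c * ∫⁻ x, bump x := by
  have hms : Measurable fun x : Plane => bump (((n : ℝ) + 1)⁻¹ • x) :=
    continuous_bump.measurable.comp (measurable_const_smul _)
  have hn : ENNReal.ofReal (((n : ℝ) + 1) ^ 2)⁻¹
      * ENNReal.ofReal ((((n : ℝ) + 1)⁻¹) ^ 2)⁻¹ = 1 := by
    rw [← ENNReal.ofReal_mul (by positivity), ← ENNReal.ofReal_one]
    congr 1
    field_simp
  have h1 : ∫⁻ x, bump (((n : ℝ) + 1)⁻¹ • x) ∂intensity P (shiftedLattice η)
      = c * (ENNReal.ofReal ((((n : ℝ) + 1)⁻¹) ^ 2)⁻¹ * ∫⁻ x, bump x) := by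
    rw [hc, lintegral_smul_measure,
      lintegral_comp_smul (by positivity) _ continuous_bump.measurable, smul_eq_mul]
  rw [lintegral_intensity _ _ _ hms] at h1
  let S : ASL → ℝ≥0∞ := fun g =>
    ∑' v : shiftedLattice η, bump (((n : ℝ) + 1)⁻¹ • ((v : Plane) ᵥ* (g.lin : Mat)))
  have h2 : ∀ g : ASL, ∑' m, bump (((n : ℝ) + 1)⁻¹ • ((toPlane m + η) ᵥ* (g.lin : Mat)))
      = S g := by
    intro g
    refine (tsum_shiftedLattice η
      (fun v => bump (((n : ℝ) + 1)⁻¹ • (v ᵥ* (g.lin : Mat)))) ?_).symm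
    simp only [Matrix.zero_vecMul, smul_zero, bump_zero]
  have hS : Measurable S := Measurable.tsum fun v => hms.comp (measurable_vecMul_lin _)
  simp_rw [h2]
  rw [lintegral_const_mul _ hS, h1, mul_left_comm,
    ← mul_assoc (ENNReal.ofReal _) (ENNReal.ofReal _), hn, one_mul]

theorem IsLift.lintegral_shortCount_ne_top {P : Measure ASL} (hP : IsLift P) :
    ∫⁻ g, shortCount g.lin ∂P ≠ ∞ := by
  have := hP.prob
  obtain ⟨d, hd, hd0⟩ := hP.exists_intensity_shiftedLattice_zero
  have h := lintegral_intensity P (shiftedLattice 0)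
    ((Metric.ball (0 : Plane) 1).indicator (1 : Plane → ℝ≥0∞))
    (measurable_one.indicator measurableSet_ball)
  rw [hd0, lintegral_smul_measure, lintegral_indicator_one measurableSet_ball, smul_eq_mul] at h
  exact h.symm.trans_ne (ENNReal.mul_ne_top hd measure_ball_lt_top.ne)

theorem measurable_shortCount : Measurable fun g : ASL => shortCount g.lin :=
  Measurable.tsum fun _ =>
    (measurable_one.indicator measurableSet_ball).comp (measurable_vecMul_lin _)

/-- Siegel's mean value formula for the translates of `ℤ²` that are stable under the congruence
subgroup. -/
theorem IsLift.intensity_shiftedLattice {P : Measure ASL} (hP : IsLift P) {η : Plane}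
    (hη : IsStable (shiftedLattice η)) : intensity P (shiftedLattice η) = volume := by
  have := hP.prob
  obtain ⟨c, hc⟩ := hP.exists_intensity_eq hη (zero_notMem_shiftedLattice η)
  let A : ℕ → ASL → ℝ≥0∞ := fun n g => ENNReal.ofReal (((n : ℝ) + 1) ^ 2)⁻¹ *
    ∑' m, bump (((n : ℝ) + 1)⁻¹ • ((toPlane m + η) ᵥ* (g.lin : Mat)))
  have hA : ∀ n, Measurable (A n) := fun n => Measurable.const_mul (Measurable.tsum fun _ =>
    continuous_bump.measurable.comp
      ((measurable_const_smul _).comp (measurable_vecMul_lin _))) _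
  have hbound : ∫⁻ g, 4 * (1 + shortCount g.lin) ∂P ≠ ∞ := by
    rw [lintegral_const_mul _ (measurable_shortCount.const_add 1),
      lintegral_add_left measurable_const]
    exact ENNReal.mul_ne_top (by simp)
      (ENNReal.add_ne_top.2 ⟨by simp, hP.lintegral_shortCount_ne_top⟩)
  have hlim : Filter.Tendsto (fun n => ∫⁻ g, A n g ∂P) Filter.atTop
      (nhds (∫⁻ _, (∫⁻ x, bump x) ∂P)) :=
    tendsto_lintegral_of_dominated_convergence (fun g => 4 * (1 + shortCount g.lin)) hA
      (fun n => Filter.Eventually.of_forall fun g => tsum_bump_le g.lin η n) hbound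
      (Filter.Eventually.of_forall fun g => tendsto_tsum_bump g.lin η)
  have hmean : ∀ n, ∫⁻ g, A n g ∂P = c * ∫⁻ x, bump x := lintegral_rescaled_bump hc
  simp_rw [hmean] at hlim
  have h1 := tendsto_nhds_unique tendsto_const_nhds hlim
  rw [lintegral_const, measure_univ, mul_one] at h1
  have hc1 : c = 1 := by
    rw [← ENNReal.mul_left_inj lintegral_bump_ne_zero lintegral_bump_ne_top, h1, one_mul]
  rw [hc, hc1, one_smul]

/-! ### Joint intensity of points and difference vectors -/

/-- The random point of the plane and the random vector attached to a point of `ℤ²` and a nonzero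
vector of `ℤ² + η`. -/
def pointVector (η : Plane) (q : Lattice × shiftedLattice η) (g : ASL) : Plane × Plane :=
  (act (toPlane q.1) g, (q.2 : Plane) ᵥ* (g.lin : Mat))

theorem measurable_pointVector (η : Plane) (q : Lattice × shiftedLattice η) :
    Measurable (pointVector η q) :=
  (measurable_act _).prodMk (measurable_vecMul_lin _)

theorem IsLift.sum_map_pointVector {P : Measure ASL} (hP : IsLift P) {η : Plane}
    (hη : IsStable (shiftedLattice η)) :
    Measure.sum (fun q => P.map (pointVector η q)) = volume := by
  have := hP.prob
  refine Measure.ext_of_lintegral _ fun F hF => ?_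
  have hH : Measurable fun q : ASL × Plane =>
      ∑' v : shiftedLattice η, F (q.2, (v : Plane) ᵥ* (q.1.lin : Mat)) :=
    Measurable.tsum fun v => hF.comp
      (measurable_snd.prodMk ((measurable_vecMul_lin _).comp measurable_fst))
  have hC := hP.lintegral_tsum_act
    (fun g x => ∑' v : shiftedLattice η, F (x, (v : Plane) ᵥ* (g.lin : Mat))) hH
    (fun g h hgh => by rw [hgh]) (by
      rintro γ ⟨⟨A, hA, hγA⟩, -⟩ g
      ext x
      rw [ASL.mul_lin, hγA]
      exact hη.tsum_mul hA g.lin fun v => F (x, v))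
  have hFi : ∀ q, Measurable fun g => F (pointVector η q g) := fun q =>
    hF.comp (measurable_pointVector η q)
  calc ∫⁻ z, F z ∂Measure.sum (fun q => P.map (pointVector η q))
      = ∑' q, ∫⁻ g, F (pointVector η q g) ∂P := by
        rw [lintegral_sum_measure]
        exact tsum_congr fun q => lintegral_map hF (measurable_pointVector η q)
    _ = ∫⁻ g, ∑' m, ∑' v : shiftedLattice η,
          F (act (toPlane m) g, (v : Plane) ᵥ* (g.lin : Mat)) ∂P := by
        rw [← lintegral_tsum fun q => (hFi q).aemeasurable]
        exact lintegral_congr fun g => ENNReal.tsum_prod'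
    _ = ∫⁻ x, (∫⁻ g, ∑' v : shiftedLattice η, F (x, (v : Plane) ᵥ* (g.lin : Mat)) ∂P) := by
        rw [hC, lintegral_lintegral_swap hH.aemeasurable]
    _ = ∫⁻ x, (∫⁻ y, F (x, y)) := by
        refine lintegral_congr fun x => ?_
        have hFx : Measurable fun y => F (x, y) := hF.comp measurable_prodMk_left
        rw [← lintegral_intensity P (shiftedLattice η) _ hFx, hP.intensity_shiftedLattice hη]
    _ = ∫⁻ z, F z := by
        rw [Measure.volume_eq_prod, lintegral_prod _ hF.aemeasurable]

theorem sum_map_equiv {ι κ : Type*} {P : Measure ASL} {z : κ → ASL → Plane × Plane}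
    (hz : ∀ k, Measurable (z k)) (hsum : Measure.sum (fun k => P.map (z k)) = volume)
    {T : Plane × Plane → Plane × Plane} (hT : MeasurePreserving T volume volume)
    (e : ι ≃ κ) {w : ι → ASL → Plane × Plane} (hw : ∀ i g, w i g = T (z (e i) g)) :
    (∀ i, Measurable (w i)) ∧ Measure.sum (fun i => P.map (w i)) = volume := by
  have hw' : ∀ i, w i = T ∘ z (e i) := fun i => funext (hw i)
  refine ⟨fun i => hw' i ▸ hT.measurable.comp (hz _), ?_⟩
  rw [← hT.map_eq, ← hsum, Measure.map_sum hT.measurable.aemeasurable]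
  ext s hs
  rw [Measure.sum_apply _ hs, Measure.sum_apply _ hs,
    ← e.tsum_eq fun k => ((P.map (z k)).map T) s]
  refine tsum_congr fun i => ?_
  rw [hw', Measure.map_map hT.measurable (hz _)]

/-- Campbell's formula: Tonelli for `‖f‖ₑ` gives summability and integrability, after which sum and
integral may be exchanged. -/
theorem integral_tsum_of_sum_map {ι α β : Type*} [Countable ι] [MeasurableSpace α]
    [MeasurableSpace β] {P : Measure α} {ρ : Measure β} {w : ι → α → β}
    (hw : ∀ i, Measurable (w i)) (hsum : Measure.sum (fun i => P.map (w i)) = ρ)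
    {f : β → ℝ} (hf : Integrable f ρ) :
    (∀ᵐ g ∂P, Summable fun i => f (w i g)) ∧ Integrable (fun g => ∑' i, f (w i g)) P ∧
      ∫ g, ∑' i, f (w i g) ∂P = ∫ z, f z ∂ρ := by
  subst hsum
  have hm : ∀ i, AEStronglyMeasurable f (P.map (w i)) :=
    aestronglyMeasurable_sum_measure_iff.1 hf.1
  have hm' : ∀ i, AEStronglyMeasurable (fun g => f (w i g)) P := fun i =>
    (hm i).comp_measurable (hw i)
  have hfin : ∫⁻ g, ∑' i, ‖f (w i g)‖ₑ ∂P < ∞ := by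
    rw [lintegral_tsum fun i => (hm' i).enorm]
    have := hf.2
    rw [hasFiniteIntegral_iff_enorm, lintegral_sum_measure] at this
    refine lt_of_le_of_lt (le_of_eq (tsum_congr fun i => ?_)) this
    exact (lintegral_map' (hm i).enorm (hw i).aemeasurable).symm
  refine ⟨?_, ⟨?_, ?_⟩, ?_⟩
  · filter_upwards [ae_lt_top' (AEMeasurable.tsum fun i => (hm' i).enorm) hfin.ne] with g hg
    exact (tsum_enorm_ne_top_iff_summable_norm.1 hg.ne).of_norm
  · exact (AEMeasurable.tsum fun i => (hm' i).aemeasurable).aestronglyMeasurable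
  · exact (lintegral_mono fun g => enorm_tsum_le_tsum_enorm).trans_lt hfin
  · rw [integral_tsum hm' (by
      rw [← lintegral_tsum fun i => (hm' i).enorm]
      exact hfin.ne), ← (hasSum_integral_measure hf).tsum_eq]
    exact tsum_congr fun i => (integral_map (hw i).aemeasurable (hm i)).symm

/-! ### Descent to `Y` and the two two-point sums -/

theorem integral_eq_of_section {μ : Measure Y} {s : Y → ASL} (hs : Measurable s)
    (hsec : ∀ y, coset (s y) = y) {ι : Type*} {t : ASL → ι → ℝ} {R : Y → ℝ}
    (hR : ∀ g, R (coset g) = ∑' i, t g i) {I : ℝ}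
    (hinv : ∀ γ ∈ Lam, ∀ g, Summable (t g) → Summable (t (γ * g)))
    (h : (∀ᵐ g ∂μ.map s, Summable (t g)) ∧ Integrable (fun g => ∑' i, t g i) (μ.map s) ∧
      ∫ g, ∑' i, t g i ∂μ.map s = I) :
    (∀ᵐ y ∂μ, ∀ g, coset g = y → Summable (t g)) ∧ Integrable R μ ∧ ∫ y, R y ∂μ = I := by
  obtain ⟨h1, h2, h3⟩ := h
  have hRs : R = (fun g => ∑' i, t g i) ∘ s := by
    ext y
    rw [Function.comp_apply, ← hR, hsec]
  refine ⟨?_, ?_, ?_⟩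
  · filter_upwards [ae_of_ae_map hs.aemeasurable h1] with y hy g hg
    obtain ⟨γ, hγ, rfl⟩ := (coset_eq_iff _ _).1 ((hsec y).trans hg.symm)
    exact hinv γ hγ _ hy
  · rw [hRs]
    exact (integrable_map_measure h2.1 hs.aemeasurable).1 h2
  · rw [← h3, integral_map hs.aemeasurable h2.1, hRs]
    rfl

theorem summable_termPlus_mul {f : Plane × Plane → ℝ} {γ : ASL} (hγ : γ ∈ Lam) {g : ASL}
    (h : Summable (termPlus f g)) : Summable (termPlus f (γ * g)) := by
  obtain ⟨e, he⟩ := exists_equiv hγ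
  have hs : ∀ p : Lattice × Lattice, p.1 ≠ p.2 ↔ (e.prodCongr e p).1 ≠ (e.prodCongr e p).2 :=
    fun p => by simp
  rw [← (Equiv.subtypeEquiv (e.prodCongr e) hs).summable_iff] at h
  refine h.congr fun p => ?_
  simp [termPlus, act_mul, he]

theorem summable_termMinus_mul {f : Plane × Plane → ℝ} {γ : ASL} (hγ : γ ∈ Lam) {g : ASL}
    (h : Summable (termMinus f g)) : Summable (termMinus f (γ * g)) := by
  obtain ⟨e, he⟩ := exists_equiv hγ
  obtain ⟨d, hd⟩ := exists_equiv (shift_conj hγ)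
  rw [← (e.prodCongr d).summable_iff] at h
  refine h.congr fun p => ?_
  have hc : shift * (γ * g) = (shift * γ * shift⁻¹) * (shift * g) := by group
  simp only [termMinus, hc, Function.comp_apply]
  rw [act_mul _ γ g, act_mul _ (shift * γ * shift⁻¹) (shift * g), he, hd]
  rfl

/-- Conjugating `(γ, 0)` by the shift gives translation part `ηγ - η`, which is integral because the
shift normalizes `Λ`. -/
theorem isStable_shiftedLattice_shift : IsStable (shiftedLattice shift.trans) := by
  refine isStable_shiftedLattice fun γ hγ => ?_
  have hmem : (⟨toReal γ, 0⟩ : ASL) ∈ Lam :=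
    ⟨⟨γ, hγ, rfl⟩, 0, by
      ext i
      simp [toPlane]⟩
  obtain ⟨-, n, hn⟩ := shift_conj hmem
  refine ⟨n, ?_⟩
  have h1 : shift.lin = 1 := rfl
  rw [← hn, ASL.mul_trans, ASL.mul_trans, ASL.inv_lin, ASL.inv_trans, h1, inv_one]
  simp

theorem toPlane_sub (m n : Lattice) : toPlane (m - n) = toPlane m - toPlane n := by
  rw [sub_eq_add_neg, toPlane_add, toPlane_neg, sub_eq_add_neg]

/-- The first coordinate is a half-integer. This is why the minus sum needs no restriction on `(m₁,
m₂)`. -/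
theorem toPlane_add_shift_ne_zero (m : Lattice) : toPlane m + shift.trans ≠ 0 := by
  intro h
  have h0 := congrFun h 0
  simp only [shift, toPlane, Pi.add_apply, Matrix.cons_val_zero, Pi.zero_apply] at h0
  have h1 : (2 : ℝ) * m 0 + 1 = 0 := by linarith
  have h2 : 2 * m 0 + 1 = 0 := by exact_mod_cast h1
  omega

/-- The pair `(m₁, m₂)` viewed as a point and a nonzero difference vector. -/
def plusEquiv : DistinctPairs ≃ Lattice × shiftedLattice 0 :=
  Equiv.ofBijective
    (fun p => (p.1.1, ⟨toPlane (p.1.2 - p.1.1), fun h => p.2 (sub_eq_zero.1 (toPlane_injective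
      (h.trans (by ext; simp [toPlane])))).symm, _, add_zero _⟩)) (by
    constructor
    · rintro ⟨⟨a, b⟩, hab⟩ ⟨⟨c, d⟩, hcd⟩ h
      simp only [Prod.mk.injEq] at h
      obtain ⟨rfl, h⟩ := h
      have := sub_left_injective (toPlane_injective (congrArg Subtype.val h))
      subst this
      rfl
    · rintro ⟨a, v, hv, m, rfl⟩
      refine ⟨⟨(a, m + a), fun h => hv ?_⟩, ?_⟩
      · have h0 : m = 0 := by simpa using h.symm
        ext
        simp [h0, toPlane]
      · simp)

/-- The pair `(m₁, m₂)` viewed as a point and the difference vector to the shift of `m₂`. -/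
def minusEquiv : Lattice × Lattice ≃ Lattice × shiftedLattice shift.trans :=
  Equiv.ofBijective
    (fun p => (p.1, ⟨toPlane (p.2 - p.1) + shift.trans, toPlane_add_shift_ne_zero _, _, rfl⟩)) (by
    constructor
    · rintro ⟨a, b⟩ ⟨c, d⟩ h
      simp only [Prod.mk.injEq] at h
      obtain ⟨rfl, h⟩ := h
      have := sub_left_injective (toPlane_injective (add_right_cancel (congrArg Subtype.val h)))
      subst this
      rfl
    · rintro ⟨a, v, hv, m, rfl⟩
      exact ⟨(a, m + a), by simp⟩)

theorem measurePreserving_shear :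
    MeasurePreserving (fun z : Plane × Plane => (z.1, z.1 + z.2)) volume volume :=
  measurePreserving_prod_add volume volume

theorem measurePreserving_neg_shear :
    MeasurePreserving (fun z : Plane × Plane => (z.1, -(z.1 + z.2))) volume volume :=
  ((MeasurePreserving.id volume).prod (Measure.measurePreserving_neg volume)).comp
    measurePreserving_shear

theorem plusEquiv_spec (p : DistinctPairs) (g : ASL) :
    (act (toPlane p.1.1) g, act (toPlane p.1.2) g)
      = (fun z : Plane × Plane => (z.1, z.1 + z.2)) (pointVector 0 (plusEquiv p) g) := by
  refine Prod.ext rfl ?_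
  change _ = act (toPlane p.1.1) g + toPlane (p.1.2 - p.1.1) ᵥ* (g.lin : Mat)
  rw [toPlane_sub, Matrix.sub_vecMul]
  simp only [act]
  abel

theorem minusEquiv_spec (p : Lattice × Lattice) (g : ASL) :
    (act (toPlane p.1) g, -(act (toPlane p.2) (shift * g)))
      = (fun z : Plane × Plane => (z.1, -(z.1 + z.2)))
          (pointVector shift.trans (minusEquiv p) g) := by
  refine Prod.ext rfl (congrArg Neg.neg ?_)
  change _ = act (toPlane p.1) g + (toPlane (p.2 - p.1) + shift.trans) ᵥ* (g.lin : Mat)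
  have hs : act (toPlane p.2) shift = toPlane p.2 + shift.trans := by simp [act, shift]
  rw [act_mul, hs, toPlane_sub, Matrix.add_vecMul, Matrix.sub_vecMul]
  simp only [act, Matrix.add_vecMul]
  abel

end TwoPoint

end

theorem theorem4 (μ : Measure TwoPoint.Y) (hμ : TwoPoint.IsInvariantProbability μ)
    (f : TwoPoint.Plane × TwoPoint.Plane → ℝ) (hf : Integrable f volume) :
    ((∀ᵐ y ∂μ, ∀ g : TwoPoint.ASL, TwoPoint.coset g = y →
          Summable (TwoPoint.termPlus f g)) ∧
        Integrable (TwoPoint.Rplus f) μ ∧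
        ∫ y, TwoPoint.Rplus f y ∂μ = ∫ z, f z) ∧
      ((∀ᵐ y ∂μ, ∀ g : TwoPoint.ASL, TwoPoint.coset g = y →
          Summable (TwoPoint.termMinus f g)) ∧
        Integrable (TwoPoint.Rminus f) μ ∧
        ∫ y, TwoPoint.Rminus f y ∂μ = ∫ z, f z) := by
  obtain ⟨s, hs, hsec⟩ := TwoPoint.exists_measurable_section
  have hP := TwoPoint.isLift_map hμ hs hsec
  constructor
  · obtain ⟨hw, hsum⟩ := TwoPoint.sum_map_equiv (TwoPoint.measurable_pointVector 0)
      (hP.sum_map_pointVector TwoPoint.isStable_shiftedLattice_zero)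
      TwoPoint.measurePreserving_shear TwoPoint.plusEquiv TwoPoint.plusEquiv_spec
    exact TwoPoint.integral_eq_of_section hs hsec (fun _ => rfl)
      (fun γ hγ g => TwoPoint.summable_termPlus_mul hγ)
      (TwoPoint.integral_tsum_of_sum_map hw hsum hf)
  · obtain ⟨hw, hsum⟩ := TwoPoint.sum_map_equiv
      (TwoPoint.measurable_pointVector TwoPoint.shift.trans)
      (hP.sum_map_pointVector TwoPoint.isStable_shiftedLattice_shift)
      TwoPoint.measurePreserving_neg_shear TwoPoint.minusEquiv TwoPoint.minusEquiv_spec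
    exact TwoPoint.integral_eq_of_section hs hsec (fun _ => rfl)
      (fun γ hγ g => TwoPoint.summable_termMinus_mul hγ)
      (TwoPoint.integral_tsum_of_sum_map hw hsum hf)
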